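/- Let $0<\mu<3$ and $2-\mu/3<p<6-\mu$. For $v:\mathbb R^3\to\mathbb C$ put $$\mathfrak F_\mu(v)=\int_{\mathbb R^3\times\mathbb R^3}\frac{|v(x)|^p|v(y)|^p}{|x-y|^\mu}\,dx\,dy .$$ Let $V=V_1+V_2$ with $V_1,V_2:\mathbb R^3\to\mathbb R$ radial, such that: * $V_1\in C^\infty(\mathbb R^3)$, $V_1>0$, and there are $m,M>0$ with $V_1(x)\le M(1+|x|^m)$ for all $x$; * for every multi-index $\alpha$ with $|\alpha|\le 2$ there is $M_\alpha>0$ with $|x^\alpha\partial^\alpha V_1(x)|\le M_\alpha(1+V_1(x))$ for all $x$; * $\partial^\alpha V_1\in L^\infty(\mathbb R^3)$ for every multi-index $\alpha$ with $|\alpha|\ge 2$; * there is $q\geq 1$ with $q>3/2$ such that $x^\alpha\partial^\alpha V_2\in L^q(\mathbb R^3)+L^\infty(\mathbb R^3)$, in the sense of distributions, for every $|\alpha|\le2$. Let $X=\{v\in H^1(\mathbb R^3,\mathbb C): V_1|v|^2\in L^1(\mathbb R^3)\}$, a real Hilbert space with inner product $\operatorname{Re}\int_{\mathbb R^3}(v\overline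 w+\nabla v\cdot\overline{\nabla w}+V_1v\overline w)\,dx$. For $\omega>0$ and $v\in X$ put $$S_\omega(v)=\tfrac12\|\nabla v\|_2^2+\tfrac12\int_{\mathbb R^3} V|v|^2dx+\tfrac\omega2\|v\|_2^2-\tfrac1{2p}\mathfrak F_\mu(v),$$ $$I_\omega(v)=\|\nabla v\|_2^2+\omega\|v\|_2^2+\int_{\mathbb R^3} V|v|^2dx-\mathfrak F_\mu(v),$$ and let $\mathcal M_\omega$ be the set of ground states, i.e. of all $v\in X\setminus\{0\}$ with $S_\omega'(v)=0$ and $$S_\omega(v)=\inf\{S_\omega(w): w\in X\setminus\{0\},\ I_\omega(w)=0\}.$$ Let $\psi_1$ be a ground state of the limit equation $-\Delta\psi+\psi=(|x|^{-\mu}*|\psi|^p)|\psi|^{p-2}\psi$ in $\mathbb R^3$, i.e. an element of the set defined in the same way with $V$ and $V_1$ replaced by $0$ (so that $X=H^1(\mathbb R^3,\mathbb C)$) and $\omega=1$. For all sufficiently large $\omega$ let $\varphi_\omega\in\mathcal M_\omega$, and define $\widetilde\varphi_\omega$ by $$\varphi_\omega(x)=\omega^{\frac{5-\mu}{4(p-1)}}\,\widetilde\varphi_\omega(\sqrt\omega\,x).$$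 Then, with $\|v\|_{H^1}^2=\|\nabla v\|_2^2+\|v\|_2^2$: 1. $\displaystyle\lim_{\omega\to\infty}\mathfrak F_\mu(\widetilde\varphi_\omega)=\mathfrak F_\mu(\psi_1)$; 2. $\displaystyle\lim_{\omega\to\infty}\omega^{-1}\int_{\mathbb R^3}V\Big(\frac{x}{\sqrt\omega}\Big)|\widetilde\varphi_\omega(x)|^2dx=0$; 3. $\displaystyle\lim_{\omega\to\infty}\|\widetilde\varphi_\omega\|_{H^1}^2=\|\psi_1\|_{H^1}^2$. -/

import Mathlib

open MeasureTheory Filter Topology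

noncomputable section

namespace Choquard

/-- Three-dimensional Euclidean space. -/
abbrev E3 : Type := EuclideanSpace ℝ (Fin 3)

/-- Smooth, compactly supported, real-valued test functions. -/
def IsTest (η : E3 → ℝ) : Prop := ContDiff ℝ (⊤ : ℕ∞) η ∧ HasCompactSupport η

/-- The classical partial derivative in the `i`-th coordinate direction. -/
def partialD (i : Fin 3) (f : E3 → ℝ) : E3 → ℝ :=
  fun x => fderiv ℝ f x (EuclideanSpace.single i 1)

/-- The classical derivative `∂^α f`, for a multi-index `α`. -/
def multiD (α : Fin 3 → ℕ) (f : E3 → ℝ) : E3 → ℝ :=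
  (partialD 0)^[α 0] ((partialD 1)^[α 1] ((partialD 2)^[α 2] f))

/-- The order `|α|` of a multi-index. -/
def order (α : Fin 3 → ℕ) : ℕ := ∑ i, α i

/-- The monomial `x^α`. -/
def monom (α : Fin 3 → ℕ) (x : E3) : ℝ := ∏ i, x i ^ α i

/-! ### The potential -/

/-- `G` belongs to `L^q + L^∞`. -/
def MemLqAddLinfty (q : ℝ) (G : E3 → ℝ) : Prop :=
  ∃ g₁ g₂ : E3 → ℝ, MemLp g₁ (ENNReal.ofReal q) volume ∧ MemLp g₂ ⊤ volume ∧
    G =ᵐ[volume] g₁ + g₂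

/-- For `W` locally integrable: the distribution `x^α ∂^α W` is the function `G`, that is,
`⟨G, η⟩ = (-1)^|α| ⟨W, ∂^α (x^α η)⟩` for all test functions `η`. -/
def IsWeightedDeriv (α : Fin 3 → ℕ) (W G : E3 → ℝ) : Prop :=
  ∀ η : E3 → ℝ, IsTest η →
    ∫ x, G x * η x = (-1) ^ order α * ∫ x, W x * multiD α (fun y => monom α y * η y) x

/-- A function on space which only depends on `|x|`. -/
def IsRadial (f : E3 → ℝ) : Prop := ∀ x y : E3, ‖x‖ = ‖y‖ → f x = f y

/-- The standing conditions on the potential `V = V₁ + V₂`. -/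
structure PotentialConditions (V V₁ V₂ : E3 → ℝ) : Prop where
  decomp : ∀ x, V x = V₁ x + V₂ x
  radial₁ : IsRadial V₁
  radial₂ : IsRadial V₂
  contDiff_two : ContDiff ℝ 2 V₁
  growth : ∃ m > (0 : ℝ), ∃ M > (0 : ℝ), ∀ x, 0 ≤ V₁ x ∧ V₁ x ≤ M * (1 + ‖x‖ ^ m)
  weighted : ∀ α : Fin 3 → ℕ, order α ≤ 2 →
    ∃ M > (0 : ℝ), ∀ x, |monom α x * multiD α V₁ x| ≤ M * (1 + V₁ x)
  smooth : ContDiff ℝ (⊤ : ℕ∞) V₁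
  pos : ∀ x, 0 < V₁ x
  bounded_deriv : ∀ α : Fin 3 → ℕ, 2 ≤ order α → ∃ C : ℝ, ∀ x, |multiD α V₁ x| ≤ C
  /-- `V₂` itself and the distributions `x^α ∂^α V₂`, `|α| ≤ 2`, lie in `L^q + L^∞`. -/
  singular : ∃ q : ℝ, 1 ≤ q ∧ 3 / 2 < q ∧ MemLqAddLinfty q V₂ ∧
    ∀ α : Fin 3 → ℕ, order α ≤ 2 →
      ∃ G : E3 → ℝ, MemLqAddLinfty q G ∧ IsWeightedDeriv α V₂ G

/-! ### Sobolev functions, and the spaces `H¹` and `X` -/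

/-- For `v`, `g` locally integrable: `g` is the weak derivative `∂_i v`. -/
def HasWeakDeriv (i : Fin 3) (v g : E3 → ℂ) : Prop :=
  ∀ η : E3 → ℝ, IsTest η → ∫ x, partialD i η x • v x = -∫ x, η x • g x

/-- `v ∈ H¹(ℝ³, ℂ)`. -/
def MemH1 (v : E3 → ℂ) : Prop :=
  MemLp v 2 volume ∧ ∀ i, ∃ g : E3 → ℂ, MemLp g 2 volume ∧ HasWeakDeriv i v g

open Classical in
/-- The weak derivative `∂_i v ∈ L²` of `v ∈ H¹` (unique up to null sets; `0` if there is none). -/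
def weakD (i : Fin 3) (v : E3 → ℂ) : E3 → ℂ :=
  if h : ∃ g : E3 → ℂ, MemLp g 2 volume ∧ HasWeakDeriv i v g then h.choose else 0

/-- `‖v‖₂²` -/
def normSqL2 (v : E3 → ℂ) : ℝ := ∫ x, ‖v x‖ ^ 2

/-- `‖∇v‖₂²` -/
def gradSq (v : E3 → ℂ) : ℝ := ∑ i, normSqL2 (weakD i v)

/-- `‖v‖²_{H¹} = ‖∇v‖₂² + ‖v‖₂²` -/
def normSqH1 (v : E3 → ℂ) : ℝ := gradSq v + normSqL2 v

/-- `v ∈ X`, that is, `v ∈ H¹` and `V₁ |v|² ∈ L¹`. -/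
def MemX (V₁ : E3 → ℝ) (v : E3 → ℂ) : Prop :=
  MemH1 v ∧ Integrable (fun x => V₁ x * ‖v x‖ ^ 2) volume

/-! ### The functionals -/

/-- `∫ V |v|²` -/
def potentialEnergy (V : E3 → ℝ) (v : E3 → ℂ) : ℝ := ∫ x, V x * ‖v x‖ ^ 2

/-- `𝔉_μ(v) = ∬ |v(x)|^p |v(y)|^p / |x - y|^μ dx dy` -/
def nonlocal (μ p : ℝ) (v : E3 → ℂ) : ℝ :=
  ∫ z : E3 × E3, ‖v z.1‖ ^ p * ‖v z.2‖ ^ p / ‖z.1 - z.2‖ ^ μ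

/-- The energy `E`. -/
def energy (μ p : ℝ) (V : E3 → ℝ) (v : E3 → ℂ) : ℝ :=
  1 / 2 * gradSq v + 1 / 2 * potentialEnergy V v - 1 / (2 * p) * nonlocal μ p v

/-- The action `S_ω = E + ω Q`, with `Q(v) = ‖v‖₂² / 2`. -/
def action (μ p ω : ℝ) (V : E3 → ℝ) (v : E3 → ℂ) : ℝ :=
  energy μ p V v + ω * (1 / 2 * normSqL2 v)

/-- The Nehari functional `I_ω`. -/
def nehari (μ p ω : ℝ) (V : E3 → ℝ) (v : E3 → ℂ) : ℝ :=
  gradSq v + ω * normSqL2 v + potentialEnergy V v - nonlocal μ p v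

/-- The Nehari set `𝒩_ω = {v ∈ X : v ≠ 0, I_ω(v) = 0}`. -/
def nehariSet (μ p ω : ℝ) (V V₁ : E3 → ℝ) : Set (E3 → ℂ) :=
  {v | MemX V₁ v ∧ ¬ v =ᵐ[volume] 0 ∧ nehari μ p ω V v = 0}

/-- `S_ω'(v) = 0` on the real Hilbert space `X`: the derivative of `S_ω` at `v` vanishes in every
direction `h ∈ X`. -/
def IsCritical (μ p ω : ℝ) (V V₁ : E3 → ℝ) (v : E3 → ℂ) : Prop :=
  ∀ h : E3 → ℂ, MemX V₁ h → HasDerivAt (fun t : ℝ => action μ p ω V (v + t • h)) 0 0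

/-- The set `ℳ_ω` of ground states: `v ∈ X`, `v ≠ 0`, `S_ω'(v) = 0` and
`S_ω(v) = inf {S_ω(w) : w ∈ 𝒩_ω}`. For `V = V₁ = 0` (so that `X = H¹`) and `ω = 1` it is the set of
ground states of the limit equation without potential. -/
def groundStates (μ p ω : ℝ) (V V₁ : E3 → ℝ) : Set (E3 → ℂ) :=
  {v | MemX V₁ v ∧ ¬ v =ᵐ[volume] 0 ∧ IsCritical μ p ω V V₁ v ∧
    IsGLB (action μ p ω V '' nehariSet μ p ω V V₁) (action μ p ω V v)}

/-- The rescaled function `ṽ(x) = ω^(-(5-μ)/(4(p-1))) v(x/√ω)`, that is,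
`v(x) = ω^((5-μ)/(4(p-1))) ṽ(√ω x)`. -/
def rescale (μ p ω : ℝ) (v : E3 → ℂ) : E3 → ℂ :=
  fun x => (ω ^ (-((5 - μ) / (4 * (p - 1)))) : ℝ) • v ((Real.sqrt ω)⁻¹ • x)

end Choquard

end

noncomputable section

namespace Choquard

/-! ### Calculus of weak derivatives -/

/-! The proof is a comparison of two variational problems; neither compactness nor uniqueness of
ground states enters. Write `n` and `f` for the squared H¹ norm and the nonlocal term of the
rescaled ground state, `P` for its rescaled potential energy, and `N` for the nonlocal term of `ψ`.
A critical point lies on its Nehari set (`IsCritical.nehari_eq_zero`), and the amplitude of the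
rescaling gives the quadratic and nonlocal terms one common factor. Hence `n + P = f`, and the
squared H¹ norm of `ψ` is also `N`.

Minimality on the Nehari set is turned into a scale-free inequality `F(φ)^(p-1) F(w) ≤ A(w)^p`, with
`A` the quadratic form (`nonlocal_rpow_mul_le`). It is used twice. In the limit problem, with the
rescaled ground state as competitor, it gives `N^(p-1) f ≤ n^p`. In the problem at frequency `ω`,
with a truncation of `ψ` as competitor, it gives `limsup f ≤ N` (`nonlocal_rescale_rpow_mul_le`);
truncation is needed because `ψ` need not have finite `V₁`-energy, while on a fixed compactly
supported function the rescaled potential energy tends to zero.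

From below, `V₁` is positive and `V₂` is form-small after rescaling: Sobolev's inequality and `q >
3/2` give `|P₂| ≤ δ n` for large `ω` (`MemLqAddLinfty.eventually_abs_scaledPotential_le`), so `(1 -
δ) n ≤ f`. These three bounds force `f` and `n` to converge to `N` (`tendsto_of_minimality`), and
then `P = f - n` tends to zero. -/

lemma IsTest.differentiable {η : E3 → ℝ} (h : IsTest η) : Differentiable ℝ η :=
  h.1.differentiable (by simp)

lemma IsTest.partialD {η : E3 → ℝ} (h : IsTest η) (i : Fin 3) : IsTest (partialD i η) := by
  refine ⟨?_, ?_⟩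
  · exact (h.1.fderiv_right (m := (⊤ : ℕ∞)) (by simp)).clm_apply contDiff_const
  · exact h.2.fderiv_apply ℝ _

lemma IsTest.integrable_smul {η : E3 → ℝ} (h : IsTest η) {v : E3 → ℂ}
    (hv : LocallyIntegrable v volume) : Integrable (fun x => η x • v x) volume :=
  hv.integrable_smul_left_of_hasCompactSupport h.1.continuous h.2

lemma partialD_mul {f g : E3 → ℝ} (hf : Differentiable ℝ f) (hg : Differentiable ℝ g) (i : Fin 3)
    (x : E3) : partialD i (fun y => f y * g y) x = partialD i f x * g x + f x * partialD i g x := by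
  simp only [partialD]
  rw [fderiv_fun_mul (hf x) (hg x)]
  simp
  ring

lemma partialD_comp_smul (f : E3 → ℝ) (c : ℝ) (i : Fin 3) (x : E3) :
    partialD i (fun y => f (c • y)) x = c * partialD i f (c • x) := by
  simp only [partialD]
  rw [fderiv_comp_smul]
  simp

lemma locallyIntegrable_of_memLp_two {v : E3 → ℂ} (hv : MemLp v 2 volume) :
    LocallyIntegrable v volume := hv.locallyIntegrable (by norm_num)

/-- The fundamental lemma of the calculus of variations. It makes `gradSq` independent of the choice
made in `weakD`, so that `gradSq_eq` can evaluate it with any explicit weak derivative. -/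
lemma HasWeakDeriv.ae_eq {i : Fin 3} {v g g' : E3 → ℂ} (h : HasWeakDeriv i v g)
    (h' : HasWeakDeriv i v g') (hg : LocallyIntegrable g volume)
    (hg' : LocallyIntegrable g' volume) : g =ᵐ[volume] g' := by
  have key := ae_eq_zero_of_integral_contDiff_smul_eq_zero (hg.sub hg') (fun η h1 h2 => by
    have ht : IsTest η := ⟨h1, h2⟩
    have e := (h η ht).symm.trans (h' η ht)
    have : ∀ x, η x • (g - g') x = η x • g x - η x • g' x := fun x => by simp [smul_sub]
    simp only [this]
    rw [integral_sub (ht.integrable_smul hg) (ht.integrable_smul hg'), sub_eq_zero]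
    exact neg_injective e)
  filter_upwards [key] with x hx
  exact sub_eq_zero.1 hx

lemma MemH1.weakD_spec {v : E3 → ℂ} (hv : MemH1 v) (i : Fin 3) :
    MemLp (weakD i v) 2 volume ∧ HasWeakDeriv i v (weakD i v) := by
  have h := hv.2 i
  rw [weakD, dif_pos h]
  exact h.choose_spec

lemma normSqL2_congr {v w : E3 → ℂ} (h : v =ᵐ[volume] w) : normSqL2 v = normSqL2 w :=
  integral_congr_ae (h.mono fun x hx => by simp [hx])

lemma memH1_of_hasWeakDeriv {v : E3 → ℂ} {g : Fin 3 → E3 → ℂ} (hv : MemLp v 2 volume)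
    (hg : ∀ i, MemLp (g i) 2 volume) (h : ∀ i, HasWeakDeriv i v (g i)) : MemH1 v :=
  ⟨hv, fun i => ⟨g i, hg i, h i⟩⟩

lemma gradSq_eq {v : E3 → ℂ} {g : Fin 3 → E3 → ℂ} (hv : MemLp v 2 volume)
    (hg : ∀ i, MemLp (g i) 2 volume) (h : ∀ i, HasWeakDeriv i v (g i)) :
    gradSq v = ∑ i, normSqL2 (g i) := by
  have hH := memH1_of_hasWeakDeriv hv hg h
  refine Finset.sum_congr rfl fun i _ => normSqL2_congr ?_
  exact (hH.weakD_spec i).2.ae_eq (h i) (locallyIntegrable_of_memLp_two (hH.weakD_spec i).1)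
    (locallyIntegrable_of_memLp_two (hg i))

lemma normSqL2_nonneg (v : E3 → ℂ) : 0 ≤ normSqL2 v := integral_nonneg fun x => by positivity

lemma gradSq_nonneg (v : E3 → ℂ) : 0 ≤ gradSq v := Finset.sum_nonneg fun _ _ => normSqL2_nonneg _

lemma integrable_norm_sq {v : E3 → ℂ} (hv : MemLp v 2 volume) :
    Integrable (fun x => ‖v x‖ ^ 2) volume := hv.integrable_norm_pow (by norm_num)

lemma normSqL2_pos {v : E3 → ℂ} (hv : MemLp v 2 volume) (h0 : ¬ v =ᵐ[volume] 0) :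
    0 < normSqL2 v := by
  refine lt_of_le_of_ne (normSqL2_nonneg v) fun h => h0 ?_
  have := (integral_eq_zero_iff_of_nonneg (fun x => by positivity) (integrable_norm_sq hv)).1 h.symm
  filter_upwards [this] with x hx
  simpa using hx

lemma normSqH1_pos {v : E3 → ℂ} (hv : MemLp v 2 volume) (h0 : ¬ v =ᵐ[volume] 0) :
    0 < normSqH1 v := add_pos_of_nonneg_of_pos (gradSq_nonneg v) (normSqL2_pos hv h0)

/-! ### Multiplication by a smooth function -/

lemma HasWeakDeriv.smooth_smul {i : Fin 3} {v g : E3 → ℂ} {χ : E3 → ℝ} (hχ : ContDiff ℝ (⊤ : ℕ∞) χ)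
    (hv : LocallyIntegrable v volume) (hg : LocallyIntegrable g volume) (h : HasWeakDeriv i v g) :
    HasWeakDeriv i (fun x => χ x • v x) (fun x => χ x • g x + Choquard.partialD i χ x • v x) := by
  intro η hη
  have hχd : Differentiable ℝ χ := hχ.differentiable (by simp)
  have hχη : IsTest (fun x => η x * χ x) := ⟨hη.1.mul hχ, hη.2.mul_right⟩
  have hdχ : ContDiff ℝ (⊤ : ℕ∞) (Choquard.partialD i χ) :=
    (hχ.fderiv_right (m := (⊤ : ℕ∞)) (by simp)).clm_apply contDiff_const
  have hηd : IsTest (fun x => η x * Choquard.partialD i χ x) := ⟨hη.1.mul hdχ, hη.2.mul_right⟩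
  have e := h _ hχη
  have e1 : ∀ x, Choquard.partialD i η x • χ x • v x
      = Choquard.partialD i (fun y => η y * χ y) x • v x
        - (η x * Choquard.partialD i χ x) • v x := by
    intro x
    rw [partialD_mul hη.differentiable hχd, smul_smul, ← sub_smul]
    ring_nf
  have e2 : ∀ x, η x • (χ x • g x + Choquard.partialD i χ x • v x)
      = (η x * χ x) • g x + (η x * Choquard.partialD i χ x) • v x := by
    intro x
    rw [smul_add, smul_smul, smul_smul]
  simp only [e1, e2]
  rw [integral_sub ((hχη.partialD i).integrable_smul hv) (hηd.integrable_smul hv),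
    integral_add (hχη.integrable_smul hg) (hηd.integrable_smul hv), e]
  ring

/-! ### Dilations -/

/-- The dilated function `x ↦ b v(x / c)`. -/
def dilate (b c : ℝ) (v : E3 → ℂ) : E3 → ℂ := fun x => b • v (c⁻¹ • x)

lemma rescale_eq_dilate (μ p ω : ℝ) (v : E3 → ℂ) :
    rescale μ p ω v = dilate (ω ^ (-((5 - μ) / (4 * (p - 1))))) (Real.sqrt ω) v := rfl

lemma integral_comp_inv_smul_E3 {F : Type*} [NormedAddCommGroup F] [NormedSpace ℝ F]
    (f : E3 → F) {c : ℝ} (hc : 0 < c) : ∫ x, f (c⁻¹ • x) = c ^ 3 • ∫ x, f x := by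
  rw [Measure.integral_comp_inv_smul_of_nonneg volume f hc.le]
  simp

lemma quasiMeasurePreserving_smul {c : ℝ} (hc : c ≠ 0) :
    Measure.QuasiMeasurePreserving (fun x : E3 => c • x) volume volume := by
  refine ⟨measurable_const_smul c, ?_⟩
  rw [Measure.map_addHaar_smul volume hc]
  exact Measure.smul_absolutelyContinuous

lemma memLp_dilate {v : E3 → ℂ} (hv : MemLp v 2 volume) (b : ℝ) {c : ℝ} (hc : 0 < c) :
    MemLp (dilate b c v) 2 volume := by
  refine MemLp.const_smul ?_ b
  have hm : AEStronglyMeasurable (fun x => v (c⁻¹ • x)) volume :=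
    hv.1.comp_quasiMeasurePreserving (quasiMeasurePreserving_smul (inv_ne_zero hc.ne'))
  rw [memLp_two_iff_integrable_sq_norm hm]
  exact (integrable_norm_sq hv).comp_smul (inv_ne_zero hc.ne')

lemma normSqL2_dilate (v : E3 → ℂ) (b : ℝ) {c : ℝ} (hc : 0 < c) :
    normSqL2 (dilate b c v) = b ^ 2 * c ^ 3 * normSqL2 v := by
  simp only [normSqL2, dilate, norm_smul, mul_pow, Real.norm_eq_abs, sq_abs]
  rw [integral_const_mul, integral_comp_inv_smul_E3 (fun x => ‖v x‖ ^ 2) hc, smul_eq_mul, mul_assoc]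

lemma HasWeakDeriv.dilate {i : Fin 3} {v g : E3 → ℂ} (h : HasWeakDeriv i v g) (b : ℝ) {c : ℝ}
    (hc : 0 < c) : HasWeakDeriv i (dilate b c v) (dilate (b * c⁻¹) c g) := by
  intro η hη
  -- The weak derivative of `v` is tested against the inversely dilated function; the rest is a
  -- change of variables.
  have hη' : IsTest (fun x => η (c • x)) := by
    refine ⟨hη.1.comp (contDiff_const_smul c), ?_⟩
    exact hη.2.comp_homeomorph (Homeomorph.smulOfNeZero c hc.ne')
  have e := h _ hη'
  simp only [partialD_comp_smul η] at e
  have e1 := integral_comp_inv_smul_E3 (fun y => (c * Choquard.partialD i η (c • y)) • v y) hc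
  have e2 := integral_comp_inv_smul_E3 (fun y => η (c • y) • g y) hc
  simp only [smul_smul, mul_inv_cancel₀ hc.ne', one_smul] at e1 e2
  have e3 : ∀ x, Choquard.partialD i η x • Choquard.dilate b c v x
      = (b * c⁻¹) • ((c * Choquard.partialD i η x) • v (c⁻¹ • x)) := by
    intro x
    simp only [Choquard.dilate, smul_smul]
    congr 1
    field_simp
  have e4 : ∀ x, η x • Choquard.dilate (b * c⁻¹) c g x = (b * c⁻¹) • (η x • g (c⁻¹ • x)) := by
    intro x
    simp only [Choquard.dilate, smul_smul]
    congr 1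
    ring
  simp only [e3, e4, integral_smul, e1, e2, e, smul_neg]

lemma MemH1.dilate {v : E3 → ℂ} (hv : MemH1 v) (b : ℝ) {c : ℝ} (hc : 0 < c) :
    MemH1 (dilate b c v) :=
  memH1_of_hasWeakDeriv (memLp_dilate hv.1 b hc)
    (fun i => memLp_dilate (hv.weakD_spec i).1 (b * c⁻¹) hc)
    fun i => (hv.weakD_spec i).2.dilate b hc

lemma MemH1.gradSq_dilate {v : E3 → ℂ} (hv : MemH1 v) (b : ℝ) {c : ℝ} (hc : 0 < c) :
    gradSq (Choquard.dilate b c v) = b ^ 2 * c * gradSq v := by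
  rw [gradSq_eq (memLp_dilate hv.1 b hc) (fun i => memLp_dilate (hv.weakD_spec i).1 (b * c⁻¹) hc)
    fun i => (hv.weakD_spec i).2.dilate b hc, gradSq, Finset.mul_sum]
  refine Finset.sum_congr rfl fun i _ => ?_
  rw [normSqL2_dilate _ _ hc]
  field_simp

/-- A linear change of variables on the six-dimensional product: the volume contributes `c ^ 6` and
the kernel `c ^ (-μ)`. -/
lemma nonlocal_dilate (μ : ℝ) {p : ℝ} (v : E3 → ℂ) {b c : ℝ} (hb : 0 ≤ b) (hc : 0 < c) :
    nonlocal μ p (dilate b c v) = (b ^ p) ^ 2 * c ^ (6 - μ) * nonlocal μ p v := by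
  have : (volume : Measure (E3 × E3)).IsAddHaarMeasure :=
    Measure.prod.instIsAddHaarMeasure volume volume
  have e := Measure.integral_comp_inv_smul_of_nonneg (volume : Measure (E3 × E3))
    (fun z : E3 × E3 => ‖v z.1‖ ^ p * ‖v z.2‖ ^ p / ‖z.1 - z.2‖ ^ μ) hc.le
  have hd : Module.finrank ℝ (E3 × E3) = 6 := by simp
  rw [hd, smul_eq_mul] at e
  have e1 : ∀ z : E3 × E3, ‖dilate b c v z.1‖ ^ p * ‖dilate b c v z.2‖ ^ p / ‖z.1 - z.2‖ ^ μ
      = ((b ^ p) ^ 2 * c ^ (-μ)) * (‖v (c⁻¹ • z).1‖ ^ p * ‖v (c⁻¹ • z).2‖ ^ p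
          / ‖(c⁻¹ • z).1 - (c⁻¹ • z).2‖ ^ μ) := by
    intro z
    simp only [dilate, Prod.smul_fst, Prod.smul_snd, ← smul_sub, norm_smul, Real.norm_eq_abs,
      abs_of_nonneg hb, abs_of_pos (inv_pos.2 hc)]
    rw [Real.mul_rpow hb (norm_nonneg _), Real.mul_rpow hb (norm_nonneg _),
      Real.mul_rpow (inv_pos.2 hc).le (norm_nonneg _), Real.inv_rpow hc.le, Real.rpow_neg hc.le]
    have : c ^ μ ≠ 0 := (Real.rpow_pos_of_pos hc μ).ne'
    field_simp
  rw [nonlocal]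
  simp only [e1]
  rw [integral_const_mul, e, nonlocal, show (6 : ℝ) - μ = -μ + (6 : ℕ) by push_cast; ring,
    Real.rpow_add_natCast hc.ne']
  ring

lemma potentialEnergy_dilate (W : E3 → ℝ) (v : E3 → ℂ) (b : ℝ) {c : ℝ} (hc : 0 < c) :
    ∫ x, W (c⁻¹ • x) * ‖dilate b c v x‖ ^ 2 = b ^ 2 * c ^ 3 * potentialEnergy W v := by
  have e := integral_comp_inv_smul_E3 (fun x => W x * ‖v x‖ ^ 2) hc
  simp only [dilate, norm_smul, mul_pow, Real.norm_eq_abs, sq_abs]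
  rw [potentialEnergy, mul_assoc, ← smul_eq_mul (c ^ 3), ← e, ← integral_const_mul]
  refine integral_congr_ae (Eventually.of_forall fun x => ?_)
  simp only
  ring

/-! ### Mollification -/

/-- The mollification `ρ ⋆ v`. -/
def mollify (ρ : E3 → ℝ) (v : E3 → ℂ) : E3 → ℂ :=
  convolution ρ v (ContinuousLinearMap.lsmul ℝ ℝ) volume

lemma mollify_apply (ρ : E3 → ℝ) (v : E3 → ℂ) (x : E3) :
    mollify ρ v x = ∫ t, ρ (x - t) • v t := by
  rw [mollify, convolution_eq_swap]
  rfl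

lemma IsTest.contDiff_mollify {ρ : E3 → ℝ} (hρ : IsTest ρ) {v : E3 → ℂ}
    (hv : LocallyIntegrable v volume) : ContDiff ℝ 1 (mollify ρ v) :=
  hρ.2.contDiff_convolution_left (n := 1) _ (hρ.1.of_le (by exact_mod_cast le_top)) hv

lemma IsTest.fderiv_mollify {ρ : E3 → ℝ} (hρ : IsTest ρ) {v g : E3 → ℂ}
    (hv : LocallyIntegrable v volume) {i : Fin 3} (h : HasWeakDeriv i v g) (x : E3) :
    fderiv ℝ (mollify ρ v) x (EuclideanSpace.single i 1) = mollify ρ g x := by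
  have hρ1 : ContDiff ℝ 1 ρ := hρ.1.of_le (by exact_mod_cast le_top)
  have hd := hρ.2.hasFDerivAt_convolution_left (μ := volume) (ContinuousLinearMap.lsmul ℝ ℝ) hρ1 hv x
  -- The reflected translate of the mollifier is the test function; the sign from the reflection
  -- cancels the one in the definition of the weak derivative.
  have hη : IsTest (fun y => ρ (x - y)) :=
    ⟨hρ.1.comp (contDiff_const.sub contDiff_id), hρ.2.comp_homeomorph (Homeomorph.subLeft x)⟩
  have e := h _ hη
  have e1 : ∀ y, Choquard.partialD i (fun y => ρ (x - y)) y = - Choquard.partialD i ρ (x - y) := by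
    intro y
    simp only [Choquard.partialD]
    have := (hρ.differentiable (x - y)).hasFDerivAt.comp y ((hasFDerivAt_id y).const_sub x)
    have e' : fderiv ℝ (fun y => ρ (x - y)) y = _ := this.fderiv
    rw [e']
    simp
  have hex : ConvolutionExists (fderiv ℝ ρ) v
      ((ContinuousLinearMap.lsmul ℝ ℝ : ℝ →L[ℝ] ℂ →L[ℝ] ℂ).precompL E3) volume :=
    (hρ.2.fderiv ℝ).convolutionExists_left _ (hρ1.continuous_fderiv (by norm_num)) hv
  have hi := (hex x).integrable_swap
  rw [mollify, hd.fderiv, convolution_eq_swap, ContinuousLinearMap.integral_apply hi,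
    mollify_apply]
  simp only [e1, neg_smul, integral_neg, neg_inj] at e
  rw [← e]
  refine integral_congr_ae (Eventually.of_forall fun t => ?_)
  simp [ContinuousLinearMap.precompL_apply, Choquard.partialD]

lemma IsTest.hasCompactSupport_mollify {ρ : E3 → ℝ} (hρ : IsTest ρ) {v : E3 → ℂ}
    (hv : HasCompactSupport v) : HasCompactSupport (mollify ρ v) :=
  HasCompactSupport.convolution _ hρ.2 hv

/-- Jensen's inequality for the average of `g` with weight `ρ`. -/
lemma enorm_mollify_sq_le {ρ : E3 → ℝ} (hρ : IsTest ρ) (h1 : ∫⁻ x, ‖ρ x‖ₑ = 1) {g : E3 → ℂ}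
    (hg : AEStronglyMeasurable g volume) (x : E3) :
    ‖mollify ρ g x‖ₑ ^ (2 : ℝ) ≤ ∫⁻ t, ‖ρ t‖ₑ * ‖g (x - t)‖ₑ ^ (2 : ℝ) := by
  have hρm : Measurable fun t => ‖ρ t‖ₑ := hρ.1.continuous.measurable.enorm
  have hgm : AEMeasurable (fun t => ‖g (x - t)‖ₑ) volume :=
    (hg.comp_quasiMeasurePreserving
      (quasiMeasurePreserving_sub_left_of_right_invariant volume x)).enorm
  -- `ν` is a probability measure, so Cauchy–Schwarz against the constant `1` gives the inequality.
  set ν := (volume : Measure E3).withDensity fun t => ‖ρ t‖ₑ with hν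
  have hac : ν ≪ volume := withDensity_absolutelyContinuous _ _
  have hν1 : ν Set.univ = 1 := by rw [hν, withDensity_apply _ MeasurableSet.univ]; simpa using h1
  have a1 : ‖mollify ρ g x‖ₑ ≤ ∫⁻ t, ‖g (x - t)‖ₑ ∂ν := by
    rw [hν, lintegral_withDensity_eq_lintegral_mul₀ hρm.aemeasurable hgm]
    refine (enorm_integral_le_lintegral_enorm _).trans (le_of_eq ?_)
    refine lintegral_congr fun t => ?_
    exact enorm_smul (ρ t) (g (x - t))
  have a2 := ENNReal.lintegral_mul_le_Lp_mul_Lq ν Real.HolderConjugate.two_two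
    (hgm.mono_ac hac) (aemeasurable_const (b := (1 : ENNReal)))
  simp only [Pi.mul_def, mul_one, ENNReal.one_rpow, lintegral_one, hν1] at a2
  calc ‖mollify ρ g x‖ₑ ^ (2 : ℝ)
      ≤ ((∫⁻ t, ‖g (x - t)‖ₑ ^ (2 : ℝ) ∂ν) ^ (1 / 2 : ℝ)) ^ (2 : ℝ) := by
        gcongr
        exact a1.trans a2
    _ = ∫⁻ t, ‖g (x - t)‖ₑ ^ (2 : ℝ) ∂ν := by
        rw [← ENNReal.rpow_mul]; norm_num
    _ = _ := by
        rw [hν, lintegral_withDensity_eq_lintegral_mul₀ hρm.aemeasurable (hgm.pow_const _)]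
        rfl

/-- Integrate the pointwise Jensen bound, exchange the integrals by Tonelli and use translation
invariance. -/
lemma eLpNorm_mollify_le {ρ : E3 → ℝ} (hρ : IsTest ρ) (h1 : ∫⁻ x, ‖ρ x‖ₑ = 1) {g : E3 → ℂ}
    (hg : AEStronglyMeasurable g volume) :
    eLpNorm (mollify ρ g) 2 volume ≤ eLpNorm g 2 volume := by
  have hρm : Measurable fun t => ‖ρ t‖ₑ := hρ.1.continuous.measurable.enorm
  rw [eLpNorm_eq_lintegral_rpow_enorm_toReal (by norm_num) (by norm_num),
    eLpNorm_eq_lintegral_rpow_enorm_toReal (by norm_num) (by norm_num)]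
  simp only [ENNReal.toReal_ofNat]
  refine ENNReal.rpow_le_rpow ?_ (by norm_num)
  calc ∫⁻ x, ‖mollify ρ g x‖ₑ ^ (2 : ℝ)
      ≤ ∫⁻ x, ∫⁻ t, ‖ρ t‖ₑ * ‖g (x - t)‖ₑ ^ (2 : ℝ) :=
        lintegral_mono fun x => enorm_mollify_sq_le hρ h1 hg x
    _ = ∫⁻ t, ∫⁻ x, ‖ρ t‖ₑ * ‖g (x - t)‖ₑ ^ (2 : ℝ) := by
        refine lintegral_lintegral_swap ?_
        refine AEMeasurable.mul (hρm.comp measurable_snd).aemeasurable (AEMeasurable.pow_const ?_ _)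
        exact (hg.comp_quasiMeasurePreserving
          (quasiMeasurePreserving_sub_of_right_invariant volume volume)).enorm
    _ = ∫⁻ t, ‖ρ t‖ₑ * ∫⁻ x, ‖g x‖ₑ ^ (2 : ℝ) := by
        refine lintegral_congr fun t => ?_
        rw [lintegral_const_mul' _ _ (by simp),
          lintegral_sub_right_eq_self (fun x => ‖g x‖ₑ ^ (2 : ℝ)) t]
    _ = ∫⁻ x, ‖g x‖ₑ ^ (2 : ℝ) := by
        rw [lintegral_mul_const _ hρm, h1, one_mul]

/-! ### The Sobolev inequality -/

lemma norm_apply_le_sum (L : E3 →L[ℝ] ℂ) :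
    ‖L‖ ≤ ∑ i, ‖L (EuclideanSpace.single i 1)‖ := by
  refine L.opNorm_le_bound (Finset.sum_nonneg fun _ _ => norm_nonneg _) fun x => ?_
  have hx : x = ∑ i, x i • (EuclideanSpace.single i (1 : ℝ) : E3) := by
    ext j
    simp [Finset.sum_apply, Pi.single_apply]
  calc ‖L x‖ = ‖∑ i, x i • L (EuclideanSpace.single i 1)‖ := by
        conv_lhs => rw [hx]
        simp
    _ ≤ ∑ i, ‖x‖ * ‖L (EuclideanSpace.single i 1)‖ := by
        refine (norm_sum_le _ _).trans (Finset.sum_le_sum fun i _ => ?_)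
        rw [norm_smul]
        gcongr
        exact PiLp.norm_apply_le x i
    _ = _ := by rw [← Finset.mul_sum, mul_comm]

/-- The constant of the Sobolev embedding `H¹ ⊂ L⁶`. -/
def sobolevConst : NNReal := SNormLESNormFDerivOfEqConst ℂ (volume : Measure E3) 2

lemma eLpNorm_six_le_of_contDiff {u : E3 → ℂ} (hu : ContDiff ℝ 1 u) (hc : HasCompactSupport u) :
    eLpNorm u 6 volume ≤ sobolevConst *
      ∑ i, eLpNorm (fun x => fderiv ℝ u x (EuclideanSpace.single i 1)) 2 volume := by
  have h := eLpNorm_le_eLpNorm_fderiv_of_eq (volume : Measure E3) hu hc (p := 2) (p' := 6)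
    (by norm_num) (by simp) (by simp; norm_num)
  refine h.trans ?_
  rw [sobolevConst]
  push_cast
  gcongr
  have hcont : ∀ i : Fin 3, Continuous fun x => fderiv ℝ u x (EuclideanSpace.single i 1) :=
    fun i => (hu.continuous_fderiv (by norm_num)).clm_apply continuous_const
  calc eLpNorm (fderiv ℝ u) 2 volume
      ≤ eLpNorm (∑ i : Fin 3, fun x => ‖fderiv ℝ u x (EuclideanSpace.single i 1)‖) 2 volume := by
        refine eLpNorm_mono_real fun x => ?_
        simpa using norm_apply_le_sum (fderiv ℝ u x)
    _ ≤ ∑ i : Fin 3, eLpNorm (fun x => ‖fderiv ℝ u x (EuclideanSpace.single i 1)‖) 2 volume :=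
        eLpNorm_sum_le (fun i _ => (hcont i).norm.aestronglyMeasurable) (by norm_num)
    _ = _ := by simp only [eLpNorm_norm]

lemma exists_mollifiers : ∃ ρ : ℕ → E3 → ℝ, (∀ k, IsTest (ρ k)) ∧
    (∀ k, ∫⁻ x, ‖ρ k x‖ₑ = 1) ∧ ∀ g : E3 → ℂ, LocallyIntegrable g volume →
      ∀ᵐ x, Tendsto (fun k => mollify (ρ k) g x) atTop (𝓝 (g x)) := by
  let φ : ℕ → ContDiffBump (0 : E3) := fun k =>
    ⟨1 / ((k : ℝ) + 1), 2 * (1 / ((k : ℝ) + 1)), by positivity,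
      lt_two_mul_self (by positivity)⟩
  refine ⟨fun k => (φ k).normed volume, fun k => ⟨(φ k).contDiff_normed,
    (φ k).hasCompactSupport_normed⟩, fun k => ?_, fun g hg => ?_⟩
  · have h0 : ∀ x, ‖(φ k).normed volume x‖ₑ = ENNReal.ofReal ((φ k).normed volume x) := fun x => by
      rw [← ofReal_norm, Real.norm_of_nonneg ((φ k).nonneg_normed x)]
    simp only [h0]
    rw [← ofReal_integral_eq_lintegral_ofReal (φ k).integrable_normed
      (Eventually.of_forall fun x => (φ k).nonneg_normed x), (φ k).integral_normed,
      ENNReal.ofReal_one]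
  -- The outer radius is always twice the inner one; this bounded ratio is what Lebesgue
  -- differentiation requires.
  · refine ContDiffBump.ae_convolution_tendsto_right_of_locallyIntegrable (K := 2) ?_ ?_ hg
    · simpa [φ] using (tendsto_one_div_add_atTop_nhds_zero_nat (𝕜 := ℝ)).const_mul 2
    · exact Eventually.of_forall fun k => le_rfl

/-- Mollification keeps the support compact, commutes with weak derivatives and does not increase L²
norms; Fatou's lemma then passes the smooth inequality to the limit. -/
lemma eLpNorm_six_le_of_hasCompactSupport {v : E3 → ℂ} {g : Fin 3 → E3 → ℂ}
    (hv : MemLp v 2 volume) (hc : HasCompactSupport v) (hg : ∀ i, MemLp (g i) 2 volume)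
    (h : ∀ i, HasWeakDeriv i v (g i)) :
    eLpNorm v 6 volume ≤ sobolevConst * ∑ i, eLpNorm (g i) 2 volume := by
  obtain ⟨ρ, h1, h2, h3⟩ := exists_mollifiers
  have hvl := locallyIntegrable_of_memLp_two hv
  refine (Lp.eLpNorm_lim_le_liminf_eLpNorm (f := fun k => mollify (ρ k) v)
    (fun k => ((h1 k).contDiff_mollify hvl).continuous.aestronglyMeasurable) v (h3 v hvl)).trans ?_
  refine liminf_le_of_frequently_le' (Eventually.of_forall fun k => ?_).frequently
  refine (eLpNorm_six_le_of_contDiff ((h1 k).contDiff_mollify hvl)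
    ((h1 k).hasCompactSupport_mollify hc)).trans ?_
  gcongr with i
  simp only [(h1 k).fderiv_mollify hvl (h i)]
  exact eLpNorm_mollify_le (h1 k) (h2 k) (hg i).1

/-! ### Cutoffs -/

/-- A smooth function which is `1` near the origin and vanishes outside the ball of radius `2`. -/
def bump : ContDiffBump (0 : E3) := ⟨1, 2, one_pos, one_lt_two⟩

/-- The cutoff function at scale `k + 1`. -/
def cutoff (k : ℕ) : E3 → ℝ := fun x => bump (((k : ℝ) + 1)⁻¹ • x)

lemma isTest_bump : IsTest bump := ⟨bump.contDiff, bump.hasCompactSupport⟩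

lemma isTest_cutoff (k : ℕ) : IsTest (cutoff k) := by
  refine ⟨bump.contDiff.comp (contDiff_const_smul _), ?_⟩
  exact bump.hasCompactSupport.comp_homeomorph
    (Homeomorph.smulOfNeZero (((k : ℝ) + 1)⁻¹) (by positivity))

lemma cutoff_nonneg (k : ℕ) (x : E3) : 0 ≤ cutoff k x := bump.nonneg

lemma cutoff_le_one (k : ℕ) (x : E3) : cutoff k x ≤ 1 := bump.le_one

lemma tendsto_inv_natCast_add_one : Tendsto (fun k : ℕ => ((k : ℝ) + 1)⁻¹) atTop (𝓝 0) := by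
  simpa using tendsto_one_div_add_atTop_nhds_zero_nat (𝕜 := ℝ)

lemma tendsto_cutoff (x : E3) : Tendsto (fun k => cutoff k x) atTop (𝓝 1) := by
  have h1 : Tendsto (fun k : ℕ => ((k : ℝ) + 1)⁻¹ • x) atTop (𝓝 ((0 : ℝ) • x)) :=
    tendsto_inv_natCast_add_one.smul_const x
  have h2 := (bump.continuous.tendsto ((0 : ℝ) • x)).comp h1
  rwa [zero_smul, bump.one_of_mem_closedBall (by simp [bump])] at h2

lemma exists_norm_partialD_bump_le : ∃ C : ℝ, 0 ≤ C ∧ ∀ i x, |partialD i bump x| ≤ C := by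
  have h : ∀ i, ∃ C : ℝ, ∀ x, ‖partialD i bump x‖ ≤ C := fun i =>
    (isTest_bump.partialD i).2.exists_bound_of_continuous (isTest_bump.partialD i).1.continuous
  choose C hC using h
  refine ⟨∑ i, |C i|, Finset.sum_nonneg fun _ _ => abs_nonneg _, fun i x => ?_⟩
  exact ((hC i x).trans (le_abs_self _)).trans
    (Finset.single_le_sum (f := fun i => |C i|) (fun _ _ => abs_nonneg _) (Finset.mem_univ i))

lemma partialD_cutoff (k : ℕ) (i : Fin 3) (x : E3) :
    partialD i (cutoff k) x = ((k : ℝ) + 1)⁻¹ * partialD i bump (((k : ℝ) + 1)⁻¹ • x) :=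
  partialD_comp_smul bump _ i x

lemma inv_natCast_add_one_le_one (k : ℕ) : ((k : ℝ) + 1)⁻¹ ≤ 1 :=
  inv_le_one_of_one_le₀ (by linarith [k.cast_nonneg (α := ℝ)])

lemma abs_partialD_cutoff_le {C : ℝ} (hC : ∀ i x, |partialD i bump x| ≤ C) (k : ℕ) (i : Fin 3)
    (x : E3) : |partialD i (cutoff k) x| ≤ ((k : ℝ) + 1)⁻¹ * C := by
  rw [partialD_cutoff, abs_mul, abs_of_pos (by positivity)]
  gcongr
  exact hC i _

/-- The truncation of `v` at scale `k + 1`. -/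
def truncate (k : ℕ) (v : E3 → ℂ) : E3 → ℂ := fun x => cutoff k x • v x

/-- The weak derivative of the truncation. -/
def truncateD (k : ℕ) (i : Fin 3) (v g : E3 → ℂ) : E3 → ℂ :=
  fun x => cutoff k x • g x + partialD i (cutoff k) x • v x

lemma norm_truncate_le (k : ℕ) (v : E3 → ℂ) (x : E3) : ‖truncate k v x‖ ≤ ‖v x‖ := by
  rw [truncate, norm_smul, Real.norm_of_nonneg (cutoff_nonneg k x)]
  exact mul_le_of_le_one_left (norm_nonneg _) (cutoff_le_one k x)

lemma norm_truncateD_le {C : ℝ} (hC0 : 0 ≤ C) (hC : ∀ i x, |partialD i bump x| ≤ C) (k : ℕ)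
    (i : Fin 3) (v g : E3 → ℂ) (x : E3) : ‖truncateD k i v g x‖ ≤ ‖g x‖ + C * ‖v x‖ := by
  refine (norm_add_le _ _).trans (add_le_add (norm_truncate_le k g x) ?_)
  rw [norm_smul, Real.norm_eq_abs]
  gcongr
  exact (abs_partialD_cutoff_le hC k i x).trans
    (mul_le_of_le_one_left hC0 (inv_natCast_add_one_le_one k))

lemma tendsto_truncate (v : E3 → ℂ) (x : E3) :
    Tendsto (fun k => truncate k v x) atTop (𝓝 (v x)) := by
  simpa [truncate] using (tendsto_cutoff x).smul_const (v x)

lemma tendsto_truncateD (i : Fin 3) (v g : E3 → ℂ) (x : E3) :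
    Tendsto (fun k => truncateD k i v g x) atTop (𝓝 (g x)) := by
  obtain ⟨C, -, hC⟩ := exists_norm_partialD_bump_le
  have h : Tendsto (fun k => partialD i (cutoff k) x) atTop (𝓝 0) := by
    refine squeeze_zero_norm (fun k => abs_partialD_cutoff_le hC k i x) ?_
    simpa using tendsto_inv_natCast_add_one.mul_const C
  simpa [truncateD] using ((tendsto_cutoff x).smul_const (g x)).add (h.smul_const (v x))

lemma aestronglyMeasurable_truncate (k : ℕ) {v : E3 → ℂ} (hv : AEStronglyMeasurable v volume) :
    AEStronglyMeasurable (truncate k v) volume :=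
  (isTest_cutoff k).1.continuous.aestronglyMeasurable.smul hv

lemma aestronglyMeasurable_truncateD (k : ℕ) (i : Fin 3) {v g : E3 → ℂ}
    (hv : AEStronglyMeasurable v volume) (hg : AEStronglyMeasurable g volume) :
    AEStronglyMeasurable (truncateD k i v g) volume :=
  (aestronglyMeasurable_truncate k hg).add
    (((isTest_cutoff k).partialD i).1.continuous.aestronglyMeasurable.smul hv)

lemma memLp_truncate (k : ℕ) {v : E3 → ℂ} (hv : MemLp v 2 volume) :
    MemLp (truncate k v) 2 volume :=
  hv.of_le (aestronglyMeasurable_truncate k hv.1) (Eventually.of_forall (norm_truncate_le k v))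

lemma memLp_truncateD (k : ℕ) (i : Fin 3) {v g : E3 → ℂ} (hv : MemLp v 2 volume)
    (hg : MemLp g 2 volume) : MemLp (truncateD k i v g) 2 volume := by
  obtain ⟨C, hC0, hC⟩ := exists_norm_partialD_bump_le
  refine (hg.norm.add (hv.norm.const_mul C)).of_le (aestronglyMeasurable_truncateD k i hv.1 hg.1)
    (Eventually.of_forall fun x => ?_)
  refine (norm_truncateD_le hC0 hC k i v g x).trans (le_of_eq ?_)
  rw [Pi.add_apply, Real.norm_of_nonneg (by positivity)]

lemma HasWeakDeriv.truncate (k : ℕ) {i : Fin 3} {v g : E3 → ℂ} (hv : MemLp v 2 volume)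
    (hg : MemLp g 2 volume) (h : HasWeakDeriv i v g) :
    HasWeakDeriv i (truncate k v) (truncateD k i v g) :=
  h.smooth_smul (isTest_cutoff k).1 (locallyIntegrable_of_memLp_two hv)
    (locallyIntegrable_of_memLp_two hg)

lemma hasCompactSupport_truncate (k : ℕ) (v : E3 → ℂ) : HasCompactSupport (truncate k v) :=
  (isTest_cutoff k).2.smul_right

lemma MemH1.truncate {v : E3 → ℂ} (hv : MemH1 v) (k : ℕ) : MemH1 (truncate k v) :=
  memH1_of_hasWeakDeriv (memLp_truncate k hv.1)
    (fun i => memLp_truncateD k i hv.1 (hv.weakD_spec i).1)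
    fun i => (hv.weakD_spec i).2.truncate k hv.1 (hv.weakD_spec i).1

lemma tendsto_normSqL2 {v : ℕ → E3 → ℂ} {w : E3 → ℂ} {B : E3 → ℝ} (hB : MemLp B 2 volume)
    (hv : ∀ k, AEStronglyMeasurable (v k) volume) (hvB : ∀ k x, ‖v k x‖ ≤ B x)
    (hlim : ∀ x, Tendsto (fun k => v k x) atTop (𝓝 (w x))) :
    Tendsto (fun k => normSqL2 (v k)) atTop (𝓝 (normSqL2 w)) := by
  refine tendsto_integral_of_dominated_convergence (fun x => B x ^ 2) (fun k => (hv k).norm.pow 2)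
    hB.integrable_sq (fun k => Eventually.of_forall fun x => ?_)
    (Eventually.of_forall fun x => (hlim x).norm.pow 2)
  rw [Real.norm_of_nonneg (by positivity)]
  gcongr
  exact hvB k x

lemma MemH1.tendsto_normSqH1_truncate {v : E3 → ℂ} (hv : MemH1 v) :
    Tendsto (fun k => normSqH1 (Choquard.truncate k v)) atTop (𝓝 (normSqH1 v)) := by
  obtain ⟨C, hC0, hC⟩ := exists_norm_partialD_bump_le
  have hg := fun i => hv.weakD_spec i
  refine Tendsto.add ?_ (tendsto_normSqL2 hv.1.norm (fun k => aestronglyMeasurable_truncate k hv.1.1)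
    (fun k x => norm_truncate_le k v x) (tendsto_truncate v))
  have e : ∀ k, gradSq (Choquard.truncate k v) = ∑ i, normSqL2 (truncateD k i v (weakD i v)) :=
    fun k => gradSq_eq (memLp_truncate k hv.1) (fun i => memLp_truncateD k i hv.1 (hg i).1)
      fun i => (hg i).2.truncate k hv.1 (hg i).1
  simp only [e]
  refine tendsto_finsetSum _ fun i _ => ?_
  exact tendsto_normSqL2 ((hg i).1.norm.add (hv.1.norm.const_mul C))
    (fun k => aestronglyMeasurable_truncateD k i hv.1.1 (hg i).1.1)
    (fun k x => norm_truncateD_le hC0 hC k i v _ x) (tendsto_truncateD i v _)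

/-- The Sobolev embedding `H¹ ⊂ L⁶`. -/
lemma exists_eLpNorm_six_le : ∃ C : NNReal, ∀ v : E3 → ℂ, MemH1 v →
    eLpNorm v 6 volume ≤ C * ∑ i, (eLpNorm (weakD i v) 2 volume + eLpNorm v 2 volume) := by
  obtain ⟨C, hC0, hC⟩ := exists_norm_partialD_bump_le
  refine ⟨sobolevConst * (1 + C.toNNReal), fun v hv => ?_⟩
  have hg := fun i => hv.weakD_spec i
  -- Fatou again, now along truncations, whose gradients cost at most an extra `C ‖v‖` uniformly in
  -- `k`.
  refine (Lp.eLpNorm_lim_le_liminf_eLpNorm (f := fun k => truncate k v)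
    (fun k => aestronglyMeasurable_truncate k hv.1.1) v
    (Eventually.of_forall (tendsto_truncate v))).trans ?_
  refine liminf_le_of_frequently_le' (Eventually.of_forall fun k => ?_).frequently
  refine (eLpNorm_six_le_of_hasCompactSupport (memLp_truncate k hv.1)
    (hasCompactSupport_truncate k v) (fun i => memLp_truncateD k i hv.1 (hg i).1)
    fun i => (hg i).2.truncate k hv.1 (hg i).1).trans ?_
  rw [ENNReal.coe_mul, mul_assoc]
  gcongr
  rw [Finset.mul_sum]
  refine Finset.sum_le_sum fun i _ => ?_
  calc eLpNorm (truncateD k i v (weakD i v)) 2 volume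
      ≤ eLpNorm ((fun x => ‖weakD i v x‖) + fun x => C * ‖v x‖) 2 volume :=
        eLpNorm_mono_real fun x => norm_truncateD_le hC0 hC k i v _ x
    _ ≤ eLpNorm (fun x => ‖weakD i v x‖) 2 volume + eLpNorm (fun x => C * ‖v x‖) 2 volume :=
        eLpNorm_add_le (hg i).1.1.norm (hv.1.1.norm.const_mul C) (by norm_num)
    _ = eLpNorm (weakD i v) 2 volume + C.toNNReal * eLpNorm v 2 volume := by
        rw [eLpNorm_norm]
        congr 1
        have := eLpNorm_const_smul C (fun x => ‖v x‖) 2 (volume : Measure E3)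
        rw [eLpNorm_norm, Real.enorm_of_nonneg hC0] at this
        exact this
    _ ≤ _ := by
        rw [ENNReal.coe_add, ENNReal.coe_one, add_mul, mul_add, mul_add, one_mul, one_mul,
          add_assoc]
        gcongr
        exact (le_add_self).trans le_add_self

/-- The Sobolev embedding in the form `∫ |v|⁶ ≤ C ‖v‖_{H¹}⁶`, after taking cube roots. -/
lemma exists_lintegral_six_le : ∃ C : ℝ, 0 < C ∧ ∀ v : E3 → ℂ, MemH1 v →
    (∫⁻ x, ‖v x‖ₑ ^ (6 : ℝ)) ^ (1 / 3 : ℝ) ≤ ENNReal.ofReal (C * normSqH1 v) := by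
  obtain ⟨C, hC⟩ := exists_eLpNorm_six_le
  have key : ∀ w : E3 → ℂ, MemLp w 2 volume →
      eLpNorm w 2 volume = ENNReal.ofReal (Real.sqrt (normSqL2 w)) := by
    intro w hw
    rw [hw.eLpNorm_eq_integral_rpow_norm (by norm_num) (by norm_num), normSqL2, Real.sqrt_eq_rpow]
    norm_num
  -- Six counts three directions with two L² norms each; the added `1` only makes the constant
  -- positive.
  refine ⟨(C * 6) ^ 2 + 1, by positivity, fun v hv => ?_⟩
  have h := hC v hv
  have hn : 0 ≤ normSqH1 v := add_nonneg (gradSq_nonneg v) (normSqL2_nonneg v)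
  have hs : ∑ i, (eLpNorm (weakD i v) 2 volume + eLpNorm v 2 volume)
      ≤ ENNReal.ofReal (6 * Real.sqrt (normSqH1 v)) := by
    calc ∑ i, (eLpNorm (weakD i v) 2 volume + eLpNorm v 2 volume)
        ≤ ∑ i : Fin 3, (ENNReal.ofReal (Real.sqrt (normSqH1 v))
            + ENNReal.ofReal (Real.sqrt (normSqH1 v))) := by
          refine Finset.sum_le_sum fun i _ => ?_
          rw [key _ (hv.weakD_spec i).1, key _ hv.1]
          gcongr
          · refine le_add_of_le_of_nonneg ?_ (normSqL2_nonneg v)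
            exact Finset.single_le_sum (f := fun i => normSqL2 (weakD i v))
              (fun _ _ => normSqL2_nonneg _) (Finset.mem_univ i)
          · exact le_add_of_nonneg_left (gradSq_nonneg v)
      _ = _ := by
          rw [← ENNReal.ofReal_add (by positivity) (by positivity), Finset.sum_const, nsmul_eq_mul,
            Finset.card_univ, Fintype.card_fin, ← ENNReal.ofReal_natCast,
            ← ENNReal.ofReal_mul (by positivity)]
          congr 1
          push_cast
          ring
  have h6 : (∫⁻ x, ‖v x‖ₑ ^ (6 : ℝ)) ^ (1 / 3 : ℝ) = eLpNorm v 6 volume ^ 2 := by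
    rw [eLpNorm_eq_lintegral_rpow_enorm_toReal (by norm_num) (by norm_num),
      ← ENNReal.rpow_two, ← ENNReal.rpow_mul]
    norm_num
  rw [h6]
  calc eLpNorm v 6 volume ^ 2
      ≤ (C * ENNReal.ofReal (6 * Real.sqrt (normSqH1 v))) ^ 2 := by
        gcongr
        exact h.trans (by gcongr)
    _ = ENNReal.ofReal ((C * 6) ^ 2 * normSqH1 v) := by
        rw [← ENNReal.ofReal_coe_nnreal, ← ENNReal.ofReal_mul (by positivity),
          ← ENNReal.ofReal_pow (by positivity)]
        congr 1
        rw [← mul_assoc, mul_pow, Real.sq_sqrt hn]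
    _ ≤ _ := by
        gcongr
        linarith

/-! ### The form bound for the singular part of the potential -/

/-- Where `|g| > k`, one has `|g|^(3/2) ≤ k^(-(q - 3/2)) |g|^q`, and the strict inequality `q > 3/2`
makes the prefactor small. -/
lemma exists_lintegral_tail_le {q : ℝ} (hq : 3 / 2 < q) {g : E3 → ℝ}
    (hg : MemLp g (ENNReal.ofReal q) volume) {ε : ℝ} (hε : 0 < ε) :
    ∃ k : ℝ, 0 < k ∧
      (∫⁻ x, ({x | k < |g x|}.indicator (fun x => ‖g x‖ₑ) x) ^ (3 / 2 : ℝ)) ^ (2 / 3 : ℝ)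
        ≤ ENNReal.ofReal ε := by
  have hq0 : 0 < q := by linarith
  have hi : Integrable (fun x => ‖g x‖ ^ q) volume := by
    have := hg.integrable_norm_rpow (by simpa using hq0) ENNReal.ofReal_ne_top
    rwa [ENNReal.toReal_ofReal hq0.le] at this
  set A := ∫ x, ‖g x‖ ^ q with hA
  have hlim : Tendsto (fun k : ℝ => k ^ (-(q - 3 / 2)) * A) atTop (𝓝 (0 * A)) :=
    (tendsto_rpow_neg_atTop (by linarith)).mul_const A
  rw [zero_mul] at hlim
  obtain ⟨k, hk, hk0⟩ := ((hlim.eventually (gt_mem_nhds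
    (Real.rpow_pos_of_pos hε (3 / 2)))).and (eventually_gt_atTop 0)).exists
  refine ⟨k, hk0, ?_⟩
  have hpt : ∀ x, ({x | k < |g x|}.indicator (fun x => ‖g x‖ₑ) x) ^ (3 / 2 : ℝ)
      ≤ ENNReal.ofReal (k ^ (-(q - 3 / 2)) * ‖g x‖ ^ q) := by
    intro x
    by_cases hx : k < |g x|
    · have hgx : 0 < |g x| := hk0.trans hx
      rw [Set.indicator_of_mem (by exact hx), ← ofReal_norm,
        ENNReal.ofReal_rpow_of_nonneg (norm_nonneg _) (by norm_num), Real.norm_eq_abs]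
      gcongr
      calc |g x| ^ (3 / 2 : ℝ) = |g x| ^ (-(q - 3 / 2)) * |g x| ^ q := by
            rw [← Real.rpow_add hgx]; congr 1; ring
        _ ≤ k ^ (-(q - 3 / 2)) * |g x| ^ q := by
            refine mul_le_mul_of_nonneg_right ?_ (by positivity)
            exact Real.rpow_le_rpow_of_nonpos hk0 hx.le (by linarith)
    · rw [Set.indicator_of_notMem (by exact hx), ENNReal.zero_rpow_of_pos (by norm_num)]
      exact zero_le
  calc _ ≤ (∫⁻ x, ENNReal.ofReal (k ^ (-(q - 3 / 2)) * ‖g x‖ ^ q)) ^ (2 / 3 : ℝ) := by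
        gcongr with x
        exact hpt x
    _ = (ENNReal.ofReal (k ^ (-(q - 3 / 2)) * A)) ^ (2 / 3 : ℝ) := by
        rw [← ofReal_integral_eq_lintegral_ofReal (hi.const_mul _)
          (Eventually.of_forall fun x => by positivity), integral_const_mul]
    _ ≤ (ENNReal.ofReal (ε ^ (3 / 2 : ℝ))) ^ (2 / 3 : ℝ) := by
        gcongr
    _ = ENNReal.ofReal ε := by
        rw [ENNReal.ofReal_rpow_of_nonneg (by positivity) (by norm_num), ← Real.rpow_mul hε.le]
        norm_num

lemma lintegral_enorm_sq {v : E3 → ℂ} (hv : MemLp v 2 volume) :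
    ∫⁻ x, ‖v x‖ₑ ^ (2 : ℝ) = ENNReal.ofReal (normSqL2 v) := by
  rw [normSqL2, ofReal_integral_eq_lintegral_ofReal (integrable_norm_sq hv)
    (Eventually.of_forall fun x => by positivity)]
  refine lintegral_congr fun x => ?_
  rw [ENNReal.rpow_two, ENNReal.ofReal_pow (norm_nonneg _), ofReal_norm]

/-- Split `W` into a tail that is small in L^(3/2) and a bounded remainder. Hölder with exponents
3/2 and 3 and the embedding in L⁶ control the tail; the remainder costs only an L² norm. -/
lemma MemLqAddLinfty.form_bound {q : ℝ} (hq : 3 / 2 < q) {W : E3 → ℝ} (hW : MemLqAddLinfty q W)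
    {δ : ℝ} (hδ : 0 < δ) : ∃ C : ℝ, 0 < C ∧ ∀ v : E3 → ℂ, MemH1 v →
      Integrable (fun x => W x * ‖v x‖ ^ 2) volume ∧
        |potentialEnergy W v| ≤ δ * normSqH1 v + C * normSqL2 v := by
  obtain ⟨g₁, g₂, hg₁, hg₂, hWg⟩ := hW
  obtain ⟨D, hD, hS⟩ := exists_lintegral_six_le
  obtain ⟨k, hk, htail⟩ := exists_lintegral_tail_le hq hg₁ (div_pos hδ hD)
  set M : ℝ := (eLpNorm g₂ ⊤ volume).toReal with hM
  have hM0 : 0 ≤ M := ENNReal.toReal_nonneg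
  have hg₂M : ∀ᵐ x, ‖g₂ x‖ₑ ≤ ENNReal.ofReal M := by
    rw [hM, ENNReal.ofReal_toReal hg₂.2.ne, eLpNorm_exponent_top]
    exact ae_le_eLpNormEssSup
  refine ⟨k + M, by positivity, fun v hv => ?_⟩
  set h : E3 → ENNReal := {x | k < |g₁ x|}.indicator (fun x => ‖g₁ x‖ₑ) with hh
  have hhm : AEMeasurable h volume :=
    hg₁.1.enorm.indicator₀ (nullMeasurableSet_lt aemeasurable_const
      (by simpa using hg₁.1.norm.aemeasurable))
  have hWm : AEStronglyMeasurable W volume := (hg₁.1.add hg₂.1).congr hWg.symm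
  have hvm : AEMeasurable (fun x => ‖v x‖ₑ ^ (2 : ℝ)) volume := hv.1.1.enorm.pow_const _
  have hn : 0 ≤ normSqH1 v := add_nonneg (gradSq_nonneg v) (normSqL2_nonneg v)
  have hpt : ∀ᵐ x, ‖W x * ‖v x‖ ^ 2‖ₑ
      ≤ h x * ‖v x‖ₑ ^ (2 : ℝ) + ENNReal.ofReal (k + M) * ‖v x‖ₑ ^ (2 : ℝ) := by
    filter_upwards [hWg, hg₂M] with x hx hx2
    have e1 : ‖W x * ‖v x‖ ^ 2‖ₑ = ‖W x‖ₑ * ‖v x‖ₑ ^ (2 : ℝ) := by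
      rw [enorm_mul, enorm_pow, enorm_norm, ENNReal.rpow_two]
    rw [e1, ← add_mul]
    gcongr
    have e2 : ‖g₁ x‖ₑ ≤ h x + ENNReal.ofReal k := by
      by_cases hkx : k < |g₁ x|
      · rw [hh, Set.indicator_of_mem (by exact hkx)]
        exact le_self_add
      · rw [← ofReal_norm]
        exact le_add_left (ENNReal.ofReal_le_ofReal (not_lt.1 hkx))
    calc ‖W x‖ₑ ≤ ‖g₁ x‖ₑ + ‖g₂ x‖ₑ := by rw [hx]; exact enorm_add_le _ _
      _ ≤ h x + ENNReal.ofReal k + ENNReal.ofReal M := by gcongr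
      _ = _ := by rw [ENNReal.ofReal_add hk.le hM0, add_assoc]
  have hfin : ∫⁻ x, ‖W x * ‖v x‖ ^ 2‖ₑ
      ≤ ENNReal.ofReal (δ * normSqH1 v + (k + M) * normSqL2 v) := by
    calc ∫⁻ x, ‖W x * ‖v x‖ ^ 2‖ₑ
        ≤ ∫⁻ x, (h x * ‖v x‖ₑ ^ (2 : ℝ) + ENNReal.ofReal (k + M) * ‖v x‖ₑ ^ (2 : ℝ)) :=
          lintegral_mono_ae hpt
      _ = (∫⁻ x, h x * ‖v x‖ₑ ^ (2 : ℝ)) + ENNReal.ofReal (k + M) * ENNReal.ofReal (normSqL2 v) := by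
          rw [lintegral_add_right' _ (hvm.const_mul _), lintegral_const_mul'' _ hvm,
            lintegral_enorm_sq hv.1]
      _ ≤ ENNReal.ofReal (δ / D) * ENNReal.ofReal (D * normSqH1 v)
            + ENNReal.ofReal (k + M) * ENNReal.ofReal (normSqL2 v) := by
          gcongr
          have hc : Real.HolderConjugate (3 / 2) 3 :=
            Real.holderConjugate_iff.2 ⟨by norm_num, by norm_num⟩
          have := ENNReal.lintegral_mul_le_Lp_mul_Lq volume hc hhm hvm
          refine this.trans ?_
          have e3 : (1 / (3 / 2) : ℝ) = 2 / 3 := by norm_num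
          have e4 : ∀ x, (‖v x‖ₑ ^ (2 : ℝ)) ^ (3 : ℝ) = ‖v x‖ₑ ^ (6 : ℝ) := fun x => by
            rw [← ENNReal.rpow_mul]; norm_num
          rw [e3]
          simp only [e4]
          gcongr
          exact hS v hv
      _ = _ := by
          rw [← ENNReal.ofReal_mul (by positivity), ← ENNReal.ofReal_mul (by positivity),
            ← ENNReal.ofReal_add (by positivity) (mul_nonneg (by positivity) (normSqL2_nonneg v))]
          congr 2
          field_simp
  refine ⟨⟨hWm.mul (hv.1.1.norm.pow 2), hfin.trans_lt ENNReal.ofReal_lt_top⟩, ?_⟩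
  rw [← Real.norm_eq_abs, ← ENNReal.ofReal_le_ofReal_iff
    (add_nonneg (by positivity) (mul_nonneg (by positivity) (normSqL2_nonneg v))), ofReal_norm]
  exact (enorm_integral_le_lintegral_enorm _).trans hfin

/-! ### The functionals along rays -/

lemma dilate_one (t : ℝ) (v : E3 → ℂ) : dilate t 1 v = t • v := by
  ext x
  simp [dilate]

lemma normSqL2_smul (t : ℝ) (v : E3 → ℂ) : normSqL2 (t • v) = t ^ 2 * normSqL2 v := by
  rw [← dilate_one, normSqL2_dilate _ _ one_pos]
  ring

lemma MemH1.gradSq_smul {v : E3 → ℂ} (hv : MemH1 v) (t : ℝ) :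
    gradSq (t • v) = t ^ 2 * gradSq v := by
  rw [← dilate_one, hv.gradSq_dilate _ one_pos]
  ring

lemma MemH1.smul {v : E3 → ℂ} (hv : MemH1 v) (t : ℝ) : MemH1 (t • v) := by
  rw [← dilate_one]
  exact hv.dilate t one_pos

lemma nonlocal_smul (μ : ℝ) {p t : ℝ} (ht : 0 ≤ t) (v : E3 → ℂ) :
    nonlocal μ p (t • v) = (t ^ p) ^ 2 * nonlocal μ p v := by
  rw [← dilate_one, nonlocal_dilate μ v ht one_pos, Real.one_rpow, mul_one]

lemma potentialEnergy_smul (W : E3 → ℝ) (t : ℝ) (v : E3 → ℂ) :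
    potentialEnergy W (t • v) = t ^ 2 * potentialEnergy W v := by
  have h := potentialEnergy_dilate W v t one_pos
  simp only [dilate_one, inv_one, one_smul, one_pow, mul_one] at h
  exact h

lemma MemX.smul {V₁ : E3 → ℝ} {v : E3 → ℂ} (hv : MemX V₁ v) (t : ℝ) : MemX V₁ (t • v) := by
  refine ⟨hv.1.smul t, (hv.2.const_mul (t ^ 2)).congr (Eventually.of_forall fun x => ?_)⟩
  simp only [Pi.smul_apply, norm_smul, mul_pow, Real.norm_eq_abs, sq_abs]
  ring

lemma nonlocal_nonneg (μ p : ℝ) (v : E3 → ℂ) : 0 ≤ nonlocal μ p v :=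
  integral_nonneg fun z => by positivity

/-- The quadratic part of the Nehari functional. -/
def quad (ω : ℝ) (V : E3 → ℝ) (v : E3 → ℂ) : ℝ :=
  gradSq v + ω * normSqL2 v + potentialEnergy V v

lemma nehari_eq (μ p ω : ℝ) (V : E3 → ℝ) (v : E3 → ℂ) :
    nehari μ p ω V v = quad ω V v - nonlocal μ p v := rfl

lemma action_eq (μ p ω : ℝ) (V : E3 → ℝ) (v : E3 → ℂ) :
    action μ p ω V v = 1 / 2 * quad ω V v - 1 / (2 * p) * nonlocal μ p v := by
  rw [action, energy, quad]
  ring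

lemma MemH1.quad_smul {v : E3 → ℂ} (hv : MemH1 v) (ω : ℝ) (V : E3 → ℝ) (t : ℝ) :
    quad ω V (t • v) = t ^ 2 * quad ω V v := by
  rw [quad, hv.gradSq_smul, normSqL2_smul, potentialEnergy_smul, quad]
  ring

lemma IsCritical.nehari_eq_zero {μ p ω : ℝ} (hp : 1 < p) {V V₁ : E3 → ℝ} {v : E3 → ℂ}
    (hv : MemX V₁ v) (h : IsCritical μ p ω V V₁ v) : nehari μ p ω V v = 0 := by
  have hd := h v hv
  have he : (fun t : ℝ => 1 / 2 * ((1 + t) ^ 2 * quad ω V v)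
      - 1 / (2 * p) * (((1 + t) ^ p) ^ 2 * nonlocal μ p v))
      =ᶠ[𝓝 0] fun t : ℝ => action μ p ω V (v + t • v) := by
    -- The variation is taken in the direction `v` itself; homogeneity of the nonlocal term is
    -- available only for `1 + t ≥ 0`, hence the restriction to a neighbourhood of zero.
    filter_upwards [lt_mem_nhds (show (-1 : ℝ) < 0 by norm_num)] with t ht
    rw [show v + t • v = (1 + t) • v by rw [add_smul, one_smul], action_eq, hv.1.quad_smul,
      nonlocal_smul μ (by linarith)]
  have h1 : HasDerivAt (fun t : ℝ => 1 + t) 1 0 := (hasDerivAt_id 0).const_add 1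
  have hd' := (((h1.pow 2).mul_const (quad ω V v)).const_mul (1 / 2)).sub
    ((((h1.rpow_const (p := p) (Or.inl (by norm_num))).pow 2).mul_const
      (nonlocal μ p v)).const_mul (1 / (2 * p)))
  have e := (hd.congr_of_eventuallyEq he).unique hd'
  rw [nehari_eq]
  norm_num at e
  field_simp at e
  linarith

/-- A ground state maximizes the quotient `𝔉_μ(w) / A(w)^p`, where `A` is the quadratic part of
the Nehari functional. -/
lemma nonlocal_rpow_mul_le {μ p ω : ℝ} (hp : 1 < p) {V V₁ : E3 → ℝ} {φ : E3 → ℂ}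
    (hφ : φ ∈ groundStates μ p ω V V₁) {w : E3 → ℂ} (hw : MemX V₁ w) (h0 : 0 < normSqL2 w)
    (hQ : 0 < quad ω V w) (hF : 0 < nonlocal μ p w) :
    nonlocal μ p φ ^ (p - 1) * nonlocal μ p w ≤ quad ω V w ^ p := by
  obtain ⟨hφX, -, hcrit, hglb⟩ := hφ
  have hnφ := hcrit.nehari_eq_zero hp hφX
  set Q := quad ω V w with hQd
  set F := nonlocal μ p w with hFd
  have hp0 : 0 < p - 1 := by linarith
  -- The solution of `t² Q = t^(2p) F`, which projects `w` onto the Nehari set along its ray.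
  set t : ℝ := (Q / F) ^ (1 / (2 * (p - 1))) with ht
  have hQF : 0 < Q / F := div_pos hQ hF
  have ht0 : 0 < t := Real.rpow_pos_of_pos hQF _
  have htp : (t ^ p) ^ 2 = (Q / F) ^ (p / (p - 1)) := by
    rw [ht, ← Real.rpow_natCast, ← Real.rpow_mul (Real.rpow_nonneg hQF.le _),
      ← Real.rpow_mul hQF.le]
    congr 1
    push_cast
    field_simp
  have ht2 : t ^ 2 = (Q / F) ^ (1 / (p - 1)) := by
    rw [ht, ← Real.rpow_natCast, ← Real.rpow_mul hQF.le]
    congr 1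
    push_cast
    field_simp
  have hbal : t ^ 2 * Q = (t ^ p) ^ 2 * F := by
    rw [htp, ht2, show p / (p - 1) = 1 / (p - 1) + 1 by field_simp; ring, Real.rpow_add hQF,
      Real.rpow_one]
    field_simp
  have hN : t • w ∈ nehariSet μ p ω V V₁ := by
    refine ⟨hw.smul t, fun h => ?_, ?_⟩
    · have := normSqL2_congr h
      rw [normSqL2_smul] at this
      have h00 : normSqL2 0 = 0 := by simp [normSqL2]
      rw [h00] at this
      have : 0 < t ^ 2 * normSqL2 w := by positivity
      linarith
    · rw [nehari_eq, hw.1.quad_smul, nonlocal_smul μ ht0.le, hbal, sub_self]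
  have hle := hglb.1 (Set.mem_image_of_mem _ hN)
  rw [action_eq, action_eq, hw.1.quad_smul, nonlocal_smul μ ht0.le, hbal] at hle
  rw [nehari_eq] at hnφ
  -- On the Nehari set the action is this positive constant times the nonlocal term, so minimal
  -- action means minimal nonlocal term.
  have hc : 0 < 1 / 2 - 1 / (2 * p) := by
    rw [sub_pos]
    exact one_div_lt_one_div_of_lt (by norm_num) (by linarith)
  have hle' : nonlocal μ p φ ≤ (t ^ p) ^ 2 * F := by
    have hq : quad ω V φ = nonlocal μ p φ := by linarith
    rw [hq] at hle
    refine le_of_mul_le_mul_left ?_ hc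
    linarith
  calc nonlocal μ p φ ^ (p - 1) * F
      ≤ ((Q / F) ^ (p / (p - 1)) * F) ^ (p - 1) * F := by
        rw [← htp]
        gcongr
        exact nonlocal_nonneg μ p φ
    _ = (Q / F) ^ p * F ^ p := by
        rw [Real.mul_rpow (by positivity) hF.le, ← Real.rpow_mul hQF.le,
          div_mul_cancel₀ _ hp0.ne', mul_assoc]
        congr 1
        nth_rewrite 2 [← Real.rpow_one F]
        rw [← Real.rpow_add hF]
        congr 1
        ring
    _ = Q ^ p := by
        rw [← Real.mul_rpow hQF.le hF.le, div_mul_cancel₀ _ hF.ne']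

/-! ### Truncation and the nonlocal term -/

lemma tendsto_nonlocal_truncate {μ p : ℝ} (hp : 0 ≤ p) {v : E3 → ℂ}
    (hv : AEStronglyMeasurable v volume) (hF : nonlocal μ p v ≠ 0) :
    Tendsto (fun k => nonlocal μ p (truncate k v)) atTop (𝓝 (nonlocal μ p v)) := by
  -- A non-integrable integrand would have integral zero by convention, so the nonvanishing integral
  -- supplies the dominating function.
  have hi : Integrable (fun z : E3 × E3 => ‖v z.1‖ ^ p * ‖v z.2‖ ^ p / ‖z.1 - z.2‖ ^ μ) volume := by
    by_contra h
    exact hF (integral_undef h)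
  refine tendsto_integral_of_dominated_convergence _ (fun k => ?_) hi
    (fun k => Eventually.of_forall fun z => ?_) (Eventually.of_forall fun z => ?_)
  · have h := (aestronglyMeasurable_truncate k hv).norm.aemeasurable.pow_const p
    have h1 : AEMeasurable (fun z : E3 × E3 => ‖truncate k v z.1‖ ^ p) volume := h.comp_fst
    have h2 : AEMeasurable (fun z : E3 × E3 => ‖truncate k v z.2‖ ^ p) volume := h.comp_snd
    have h3 : Measurable (fun z : E3 × E3 => ‖z.1 - z.2‖ ^ μ) :=
      (measurable_fst.sub measurable_snd).norm.pow_const μ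
    exact ((h1.mul h2).div h3.aemeasurable).aestronglyMeasurable
  · rw [Real.norm_of_nonneg (by positivity)]
    gcongr <;> exact norm_truncate_le k v _
  · exact (((tendsto_truncate v z.1).norm.rpow_const (Or.inr hp)).mul
      ((tendsto_truncate v z.2).norm.rpow_const (Or.inr hp))).div_const _

/-! ### The rescaled problem -/

/-- The rescaled potential energy `ω⁻¹ ∫ W(x / √ω) |u(x)|² dx`. -/
def scaledPotential (ω : ℝ) (W : E3 → ℝ) (u : E3 → ℂ) : ℝ :=
  ω⁻¹ * ∫ x, W ((Real.sqrt ω)⁻¹ • x) * ‖u x‖ ^ 2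

lemma dilate_dilate_inv {b c : ℝ} (hb : b ≠ 0) (hc : c ≠ 0) (u : E3 → ℂ) :
    dilate b c (dilate b⁻¹ c⁻¹ u) = u := by
  ext x
  simp [dilate, smul_smul, hb, hc]

lemma scaledPotential_dilate {ω : ℝ} (hω : 0 < ω) (W : E3 → ℝ) (b : ℝ) (v : E3 → ℂ) :
    scaledPotential ω W (dilate b (Real.sqrt ω) v)
      = b ^ 2 * Real.sqrt ω * potentialEnergy W v := by
  have hc := Real.sqrt_pos.2 hω
  rw [scaledPotential, potentialEnergy_dilate W v b hc]
  nth_rewrite 1 [← Real.sq_sqrt hω.le]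
  field_simp

lemma MemH1.quad_dilate {ω : ℝ} (hω : 0 < ω) (W : E3 → ℝ) (b : ℝ) {v : E3 → ℂ} (hv : MemH1 v) :
    normSqH1 (Choquard.dilate b (Real.sqrt ω) v)
        + scaledPotential ω W (Choquard.dilate b (Real.sqrt ω) v)
      = b ^ 2 * Real.sqrt ω * quad ω W v := by
  have hc := Real.sqrt_pos.2 hω
  rw [normSqH1, scaledPotential_dilate hω, hv.gradSq_dilate b hc, normSqL2_dilate v b hc, quad]
  have : Real.sqrt ω ^ 3 = Real.sqrt ω * ω := by
    rw [pow_succ', Real.sq_sqrt hω.le]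
  rw [this]
  ring

/-- The amplitude of the rescaling. -/
def amplitude (μ p ω : ℝ) : ℝ := ω ^ (-((5 - μ) / (4 * (p - 1))))

lemma amplitude_pos (μ p : ℝ) {ω : ℝ} (hω : 0 < ω) : 0 < amplitude μ p ω :=
  Real.rpow_pos_of_pos hω _

/-- The amplitude `b` solves `b^(2p) c^(6-μ) = b² c` with `c = √ω`, so this factor agrees with that
of the quadratic form in `MemH1.quad_dilate`. -/
lemma nonlocal_dilate_amplitude {μ p ω : ℝ} (hp : 1 < p) (hω : 0 < ω) (v : E3 → ℂ) :
    nonlocal μ p (dilate (amplitude μ p ω) (Real.sqrt ω) v)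
      = amplitude μ p ω ^ 2 * Real.sqrt ω * nonlocal μ p v := by
  rw [nonlocal_dilate μ v (amplitude_pos μ p hω).le (Real.sqrt_pos.2 hω)]
  congr 1
  have hp0 : p - 1 ≠ 0 := by linarith
  rw [amplitude, Real.sqrt_eq_rpow, ← Real.rpow_natCast, ← Real.rpow_natCast,
    ← Real.rpow_mul hω.le, ← Real.rpow_mul hω.le, ← Real.rpow_mul hω.le, ← Real.rpow_mul hω.le,
    ← Real.rpow_add hω, ← Real.rpow_add hω]
  congr 1
  push_cast
  field_simp
  ring

lemma integrable_mul_norm_sq {W : E3 → ℝ} (hW : Continuous W) {v : E3 → ℂ} (hv : MemLp v 2 volume)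
    (hc : HasCompactSupport v) : Integrable (fun x => W x * ‖v x‖ ^ 2) volume := by
  have h : IntegrableOn (fun x => W x * ‖v x‖ ^ 2) (tsupport v) volume :=
    (integrable_norm_sq hv).integrableOn.continuousOn_mul hW.continuousOn hc
  refine (integrableOn_iff_integrable_of_support_subset fun x hx => ?_).1 h
  refine subset_tsupport v fun h0 => hx ?_
  simp [h0]

lemma hasCompactSupport_dilate {v : E3 → ℂ} (hv : HasCompactSupport v) (b : ℝ) {c : ℝ}
    (hc : c ≠ 0) : HasCompactSupport (dilate b c v) := by
  have h := hv.comp_homeomorph (Homeomorph.smulOfNeZero (c⁻¹) (inv_ne_zero hc))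
  exact h.smul_left (f := fun _ => b)

/-- Undo the rescaling on the competitor and apply `nonlocal_rpow_mul_le`; both sides pick up the
same power `K ^ p`. Compact support puts the competitor in `X`, since `V₁` is continuous. -/
lemma nonlocal_rescale_rpow_mul_le {μ p ω : ℝ} (hp : 1 < p) (hω : 0 < ω) {V V₁ : E3 → ℝ}
    (hV₁ : Continuous V₁) {φ : E3 → ℂ} (hφ : φ ∈ groundStates μ p ω V V₁) {u : E3 → ℂ}
    (hu : MemH1 u) (hc : HasCompactSupport u) (h0 : 0 < normSqL2 u)
    (hQ : 0 < normSqH1 u + scaledPotential ω V u) (hF : 0 < nonlocal μ p u) :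
    nonlocal μ p (rescale μ p ω φ) ^ (p - 1) * nonlocal μ p u
      ≤ (normSqH1 u + scaledPotential ω V u) ^ p := by
  set b := amplitude μ p ω with hb
  set c := Real.sqrt ω with hcd
  have hb0 : 0 < b := amplitude_pos μ p hω
  have hc0 : 0 < c := Real.sqrt_pos.2 hω
  set w := dilate b⁻¹ c⁻¹ u with hw
  have huw : dilate b c w = u := dilate_dilate_inv hb0.ne' hc0.ne' u
  have hwH : MemH1 w := hu.dilate _ (inv_pos.2 hc0)
  have hwX : MemX V₁ w := ⟨hwH, integrable_mul_norm_sq hV₁ hwH.1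
    (hasCompactSupport_dilate hc _ (inv_ne_zero hc0.ne'))⟩
  have e1 := hwH.quad_dilate hω V b
  have e2 := nonlocal_dilate_amplitude (μ := μ) hp hω w
  have e3 := normSqL2_dilate w b hc0
  rw [← hcd] at e1
  rw [huw] at e1 e3
  rw [← hcd, ← hb, huw] at e2
  set K := b ^ 2 * c with hK
  have hK0 : 0 < K := by positivity
  rw [e1] at hQ
  rw [e2] at hF
  rw [e3] at h0
  have key := nonlocal_rpow_mul_le hp hφ hwX (pos_of_mul_pos_right h0 (by positivity))
    (pos_of_mul_pos_right hQ hK0.le) (pos_of_mul_pos_right hF hK0.le)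
  have hq0 : 0 ≤ quad ω V w := (pos_of_mul_pos_right hQ hK0.le).le
  rw [e1, e2, rescale_eq_dilate, ← amplitude, nonlocal_dilate_amplitude hp hω, ← hb, ← hcd, ← hK,
    Real.mul_rpow hK0.le (nonlocal_nonneg _ _ _), Real.mul_rpow hK0.le hq0]
  calc K ^ (p - 1) * nonlocal μ p φ ^ (p - 1) * (K * nonlocal μ p w)
      = K ^ (p - 1) * K * (nonlocal μ p φ ^ (p - 1) * nonlocal μ p w) := by ring
    _ = K ^ p * (nonlocal μ p φ ^ (p - 1) * nonlocal μ p w) := by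
        rw [Real.rpow_sub_one hK0.ne', div_mul_cancel₀ _ hK0.ne']
    _ ≤ _ := by gcongr

/-! ### Rescaled potential energies for large frequency -/

lemma MemLqAddLinfty.eventually_abs_scaledPotential_le {q : ℝ} (hq : 3 / 2 < q) {W : E3 → ℝ}
    (hW : MemLqAddLinfty q W) {δ : ℝ} (hδ : 0 < δ) :
    ∀ᶠ ω in atTop, ∀ u : E3 → ℂ, MemH1 u → |scaledPotential ω W u| ≤ δ * normSqH1 u := by
  -- Under dilation the L² term gains a factor `ω` relative to the gradient term, so the large
  -- constant `C` is absorbed in `δ / 2 * ω` once `ω ≥ 2 * C / δ`.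
  obtain ⟨C, hC, hb⟩ := hW.form_bound hq (half_pos hδ)
  filter_upwards [eventually_ge_atTop (max 1 (2 * C / δ))] with ω hω u hu
  have hω1 : 1 ≤ ω := (le_max_left _ _).trans hω
  have hω0 : 0 < ω := by linarith
  have hωC : C ≤ δ / 2 * ω := by
    have := (div_le_iff₀ hδ).1 ((le_max_right _ _).trans hω)
    linarith
  set c := Real.sqrt ω with hcd
  have hc0 : 0 < c := Real.sqrt_pos.2 hω0
  set v := dilate 1⁻¹ c⁻¹ u with hv
  have huv : dilate 1 c v = u := dilate_dilate_inv one_ne_zero hc0.ne' u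
  have hvH : MemH1 v := hu.dilate _ (inv_pos.2 hc0)
  have e1 := scaledPotential_dilate hω0 W 1 v
  have e2 := hvH.gradSq_dilate 1 hc0
  have e3 := normSqL2_dilate v 1 hc0
  rw [← hcd, huv] at e1
  rw [huv] at e2 e3
  have hc2 : c ^ 2 = ω := Real.sq_sqrt hω0.le
  have hbd := (hb v hvH).2
  have hg := gradSq_nonneg v
  have hl := normSqL2_nonneg v
  rw [normSqH1] at hbd
  rw [normSqH1, e1, e2, e3, abs_mul, abs_of_pos (by positivity : 0 < 1 ^ 2 * c)]
  calc 1 ^ 2 * c * |potentialEnergy W v|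
      ≤ 1 ^ 2 * c * (δ / 2 * (gradSq v + normSqL2 v) + C * normSqL2 v) := by gcongr
    _ ≤ 1 ^ 2 * c * (δ * gradSq v + δ * ω * normSqL2 v) := by
        refine mul_le_mul_of_nonneg_left ?_ (by positivity)
        have h1 : C * normSqL2 v ≤ δ / 2 * ω * normSqL2 v := by gcongr
        have h2 : δ / 2 * 1 * normSqL2 v ≤ δ / 2 * ω * normSqL2 v := by gcongr
        have h3 : 0 ≤ δ * gradSq v := by positivity
        linarith
    _ = _ := by rw [← hc2]; ring

/-- For `ω ≥ 1` the points `x / √ω` stay in a fixed ball containing the support, where `W` is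
bounded, and the prefactor `ω⁻¹` gives the decay. -/
lemma tendsto_scaledPotential_continuous {W : E3 → ℝ} (hW : Continuous W) {u : E3 → ℂ}
    (hu : MemLp u 2 volume) (hc : HasCompactSupport u) :
    Tendsto (fun ω => scaledPotential ω W u) atTop (𝓝 0) := by
  obtain ⟨R, hR⟩ := hc.isBounded.subset_closedBall (0 : E3)
  obtain ⟨B, hB⟩ := (isCompact_closedBall (0 : E3) R).exists_bound_of_continuousOn hW.continuousOn
  have hlim : Tendsto (fun ω : ℝ => ω⁻¹ * (B * normSqL2 u)) atTop (𝓝 0) := by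
    simpa using tendsto_inv_atTop_zero.mul_const (B * normSqL2 u)
  refine squeeze_zero_norm' ?_ hlim
  filter_upwards [eventually_ge_atTop 1] with ω hω
  have hω0 : 0 < ω := by linarith
  rw [scaledPotential, norm_mul, Real.norm_of_nonneg (inv_pos.2 hω0).le]
  gcongr
  rw [normSqL2, ← integral_const_mul]
  refine norm_integral_le_of_norm_le ((integrable_norm_sq hu).const_mul B)
    (Eventually.of_forall fun x => ?_)
  rw [norm_mul, Real.norm_of_nonneg (by positivity : 0 ≤ ‖u x‖ ^ 2)]
  by_cases hx : u x = 0
  · simp [hx]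
  gcongr
  refine hB _ ?_
  have hxR : ‖x‖ ≤ R := by simpa using hR (subset_tsupport u hx)
  rw [mem_closedBall_zero_iff, norm_smul, norm_inv, Real.norm_of_nonneg (Real.sqrt_nonneg _)]
  refine le_trans (mul_le_of_le_one_left (norm_nonneg _) ?_) hxR
  exact inv_le_one_of_one_le₀ (Real.one_le_sqrt.2 hω)

lemma PotentialConditions.potentialEnergy_eq {V V₁ V₂ : E3 → ℝ} (hV : PotentialConditions V V₁ V₂)
    {v : E3 → ℂ} (hv : MemX V₁ v) :
    potentialEnergy V v = potentialEnergy V₁ v + potentialEnergy V₂ v := by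
  obtain ⟨q, -, hq, hV₂, -⟩ := hV.singular
  obtain ⟨C, -, hb⟩ := hV₂.form_bound hq one_pos
  rw [potentialEnergy, potentialEnergy, potentialEnergy, ← integral_add hv.2 (hb v hv.1).1]
  refine integral_congr_ae (Eventually.of_forall fun x => ?_)
  simp only [hV.decomp x]
  ring

lemma PotentialConditions.scaledPotential_eq {V V₁ V₂ : E3 → ℝ} (hV : PotentialConditions V V₁ V₂)
    {ω : ℝ} (hω : 0 < ω) (b : ℝ) {v : E3 → ℂ} (hv : MemX V₁ v) :
    scaledPotential ω V (dilate b (Real.sqrt ω) v)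
      = scaledPotential ω V₁ (dilate b (Real.sqrt ω) v)
        + scaledPotential ω V₂ (dilate b (Real.sqrt ω) v) := by
  rw [scaledPotential_dilate hω, scaledPotential_dilate hω, scaledPotential_dilate hω,
    hV.potentialEnergy_eq hv]
  ring

lemma PotentialConditions.tendsto_scaledPotential {V V₁ V₂ : E3 → ℝ}
    (hV : PotentialConditions V V₁ V₂) {u : E3 → ℂ} (hu : MemH1 u) (hc : HasCompactSupport u) :
    Tendsto (fun ω => scaledPotential ω V u) atTop (𝓝 0) := by
  obtain ⟨q, -, hq, hV₂, -⟩ := hV.singular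
  have hV₁ : Continuous V₁ := hV.contDiff_two.continuous
  have h1 := tendsto_scaledPotential_continuous hV₁ hu.1 hc
  have h2 : Tendsto (fun ω => scaledPotential ω V₂ u) atTop (𝓝 0) := by
    have hn : 0 ≤ normSqH1 u := add_nonneg (gradSq_nonneg u) (normSqL2_nonneg u)
    rw [Metric.tendsto_nhds]
    intro ε hε
    filter_upwards [hV₂.eventually_abs_scaledPotential_le hq
      (δ := ε / (normSqH1 u + 1)) (by positivity)] with ω hω
    rw [Real.dist_eq, sub_zero]
    refine (hω u hu).trans_lt ?_
    rw [div_mul_eq_mul_div, div_lt_iff₀ (by positivity)]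
    linarith
  have h := h1.add h2
  rw [add_zero] at h
  refine h.congr' ?_
  filter_upwards [eventually_gt_atTop 0] with ω hω
  have hc0 : 0 < Real.sqrt ω := Real.sqrt_pos.2 hω
  have hvH : MemH1 (dilate 1⁻¹ (Real.sqrt ω)⁻¹ u) := hu.dilate _ (inv_pos.2 hc0)
  have e := hV.scaledPotential_eq hω 1 (v := dilate 1⁻¹ (Real.sqrt ω)⁻¹ u)
    ⟨hvH, integrable_mul_norm_sq hV₁ hvH.1 (hasCompactSupport_dilate hc _ (inv_ne_zero hc0.ne'))⟩
  rw [dilate_dilate_inv one_ne_zero hc0.ne'] at e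
  exact e.symm

/-- The contribution of `V₁` is nonnegative and is dropped; only `V₂` has to be controlled.
Membership of `v` in `X` is what allows the integral to be split. -/
lemma PotentialConditions.eventually_scaledPotential_ge {V V₁ V₂ : E3 → ℝ}
    (hV : PotentialConditions V V₁ V₂) {δ : ℝ} (hδ : 0 < δ) :
    ∀ᶠ ω in atTop, ∀ (b : ℝ) (v : E3 → ℂ), MemX V₁ v →
      -(δ * normSqH1 (dilate b (Real.sqrt ω) v))
        ≤ scaledPotential ω V (dilate b (Real.sqrt ω) v) := by
  obtain ⟨q, -, hq, hV₂, -⟩ := hV.singular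
  filter_upwards [hV₂.eventually_abs_scaledPotential_le hq hδ, eventually_gt_atTop 0]
    with ω hω hω0 b v hv
  rw [hV.scaledPotential_eq hω0 b hv]
  have h1 : 0 ≤ scaledPotential ω V₁ (dilate b (Real.sqrt ω) v) :=
    mul_nonneg (inv_pos.2 hω0).le
      (integral_nonneg fun x => mul_nonneg (hV.pos _).le (by positivity))
  have h2 := (abs_le.1 (hω _ (hv.1.dilate b (Real.sqrt_pos.2 hω0)))).1
  linarith

/-! ### The squeeze argument for real functions -/

/-- Inserting `(1 - δ) n ≤ f` into `N^(p-1) f ≤ n^p` and dividing by `n` gives `liminf n ≥ N`, hence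
`liminf f ≥ N`. Conversely `n ≤ f / (1 - δ)` carries the upper bound on `f` over to `n`. -/
lemma tendsto_of_minimality {f n : ℝ → ℝ} {N p : ℝ} (hN : 0 < N) (hp : 1 < p)
    (hlow : ∀ δ : ℝ, 0 < δ → δ < 1 → ∀ᶠ ω in atTop, (1 - δ) * n ω ≤ f ω)
    (hmin : ∀ᶠ ω in atTop, 0 < n ω ∧ N ^ (p - 1) * f ω ≤ n ω ^ p)
    (hup : ∀ a > N, ∀ᶠ ω in atTop, f ω < a) :
    Tendsto f atTop (𝓝 N) ∧ Tendsto n atTop (𝓝 N) := by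
  have hp0 : 0 < p - 1 := by linarith
  have hn : ∀ a < N, 0 < a → ∀ᶠ ω in atTop, a < n ω := by
    intro a ha ha0
    have hlt : (a / N) ^ (p - 1) < 1 :=
      Real.rpow_lt_one (by positivity) ((div_lt_one hN).2 ha) hp0
    have hpos : 0 < (a / N) ^ (p - 1) := by positivity
    -- `s` plays the role of `1 - δ`: close enough to one that `N^(p-1) s` still exceeds `a^(p-1)`.
    obtain ⟨s, hs1, hs2⟩ := exists_between hlt
    filter_upwards [hlow (1 - s) (by linarith) (by linarith), hmin] with ω h1 ⟨h2, h3⟩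
    have h4 : N ^ (p - 1) * (s * n ω) ≤ n ω ^ (p - 1) * n ω := by
      rw [← Real.rpow_add_one h2.ne', sub_add_cancel]
      refine le_trans ?_ h3
      gcongr
      simpa using h1
    have h5 : N ^ (p - 1) * s ≤ n ω ^ (p - 1) := by
      refine le_of_mul_le_mul_right ?_ h2
      linarith
    rw [← Real.rpow_lt_rpow_iff ha0.le h2.le hp0]
    refine lt_of_lt_of_le ?_ h5
    rw [Real.div_rpow ha0.le hN.le, div_lt_iff₀ (by positivity)] at hs1
    linarith
  have hf : Tendsto f atTop (𝓝 N) := by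
    refine tendsto_order.2 ⟨fun a ha => ?_, hup⟩
    obtain ⟨a₁, ha₁, ha₁N⟩ := exists_between (max_lt ha hN)
    obtain ⟨a₂, ha₂, ha₂N⟩ := exists_between ha₁N
    have ha₁0 : 0 < a₁ := (le_max_right _ _).trans_lt ha₁
    have ha₂0 : 0 < a₂ := ha₁0.trans ha₂
    have hr : a₁ / a₂ < 1 := (div_lt_one ha₂0).2 ha₂
    have hr0 : 0 < a₁ / a₂ := by positivity
    filter_upwards [hlow (1 - a₁ / a₂) (by linarith) (by linarith), hn a₂ ha₂N ha₂0] with ω h1 h2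
    calc a < a₁ := (le_max_left _ _).trans_lt ha₁
      _ = a₁ / a₂ * a₂ := by field_simp
      _ ≤ a₁ / a₂ * n ω := by gcongr
      _ ≤ f ω := by simpa using h1
  refine ⟨hf, tendsto_order.2 ⟨fun a ha => ?_, fun a ha => ?_⟩⟩
  · obtain ⟨a₁, ha₁, ha₁N⟩ := exists_between (max_lt ha hN)
    filter_upwards [hn a₁ ha₁N ((le_max_right _ _).trans_lt ha₁)] with ω h
    exact ((le_max_left _ _).trans_lt ha₁).trans h
  · obtain ⟨a₁, ha₁, ha₁a⟩ := exists_between ha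
    have ha₁0 : 0 < a₁ := hN.trans ha₁
    have ha0 : 0 < a := ha₁0.trans ha₁a
    have hr : a₁ / a < 1 := (div_lt_one ha0).2 ha₁a
    have hr0 : 0 < a₁ / a := by positivity
    filter_upwards [hlow (1 - a₁ / a) (by linarith) (by linarith), hup a₁ ha₁] with ω h1 h2
    have h3 : a₁ / a * n ω < a₁ / a * a := by
      rw [div_mul_cancel₀ _ ha0.ne']
      exact lt_of_le_of_lt (by simpa using h1) h2
    exact lt_of_mul_lt_mul_left h3 hr0.le

end Choquard

end

/-! ### The main theorem -/

open Choquard in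
theorem lemma3p1 (μ p : ℝ) (hμ0 : 0 < μ) (hμ3 : μ < 3)
    (hp1 : 2 - μ / 3 < p) (hp2 : p < 6 - μ)
    (V V₁ V₂ : Choquard.E3 → ℝ) (hV : Choquard.PotentialConditions V V₁ V₂)
    (φ : ℝ → Choquard.E3 → ℂ)
    (hφ : ∀ᶠ ω in atTop, φ ω ∈ Choquard.groundStates μ p ω V V₁)
    (ψ : Choquard.E3 → ℂ) (hψ : ψ ∈ Choquard.groundStates μ p 1 0 0) :
    Tendsto (fun ω : ℝ => Choquard.nonlocal μ p (Choquard.rescale μ p ω (φ ω))) atTop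
        (𝓝 (Choquard.nonlocal μ p ψ)) ∧
      Tendsto (fun ω : ℝ => ω⁻¹ *
          ∫ x, V ((Real.sqrt ω)⁻¹ • x) * ‖Choquard.rescale μ p ω (φ ω) x‖ ^ 2) atTop (𝓝 0) ∧
      Tendsto (fun ω : ℝ => Choquard.normSqH1 (Choquard.rescale μ p ω (φ ω))) atTop
        (𝓝 (Choquard.normSqH1 ψ)) := by
  have hp : 1 < p := by linarith
  have hp0 : 0 < p - 1 := by linarith
  have hV₁ : Continuous V₁ := hV.contDiff_two.continuous
  have hquad0 : ∀ w : E3 → ℂ, quad 1 0 w = normSqH1 w := fun w => by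
    simp [quad, normSqH1, potentialEnergy]
  have hψH : MemH1 ψ := hψ.1.1
  have hψN : normSqH1 ψ = nonlocal μ p ψ := by
    have h := hψ.2.2.1.nehari_eq_zero hp hψ.1
    rw [nehari_eq, hquad0] at h
    linarith
  have hN0 : 0 < nonlocal μ p ψ := hψN ▸ normSqH1_pos hψH.1 hψ.2.1
  have hgs : ∀ᶠ ω in atTop, 0 < ω ∧ φ ω ∈ groundStates μ p ω V V₁ ∧
      MemH1 (rescale μ p ω (φ ω)) ∧ 0 < normSqL2 (rescale μ p ω (φ ω)) ∧
      normSqH1 (rescale μ p ω (φ ω)) + scaledPotential ω V (rescale μ p ω (φ ω))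
        = nonlocal μ p (rescale μ p ω (φ ω)) := by
    filter_upwards [hφ, eventually_gt_atTop 0] with ω hω hω0
    have hc0 := Real.sqrt_pos.2 hω0
    have hb0 := amplitude_pos μ p hω0
    have hH : MemH1 (φ ω) := hω.1.1
    rw [rescale_eq_dilate, ← amplitude]
    refine ⟨hω0, hω, hH.dilate _ hc0, ?_, ?_⟩
    · rw [normSqL2_dilate _ _ hc0]
      have := normSqL2_pos hH.1 hω.2.1
      positivity
    · have h := hω.2.2.1.nehari_eq_zero hp hω.1
      rw [nehari_eq, sub_eq_zero] at h
      rw [hH.quad_dilate hω0, nonlocal_dilate_amplitude hp hω0, h]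
  have hlow : ∀ δ : ℝ, 0 < δ → δ < 1 → ∀ᶠ ω in atTop,
      (1 - δ) * normSqH1 (rescale μ p ω (φ ω)) ≤ nonlocal μ p (rescale μ p ω (φ ω)) := by
    intro δ hδ _
    filter_upwards [hgs, hV.eventually_scaledPotential_ge hδ] with ω ⟨_, hω, _, _, he⟩ hge
    have h := hge (amplitude μ p ω) (φ ω) hω.1
    rw [amplitude, ← rescale_eq_dilate] at h
    linarith
  have hmin : ∀ᶠ ω in atTop, 0 < normSqH1 (rescale μ p ω (φ ω)) ∧
      nonlocal μ p ψ ^ (p - 1) * nonlocal μ p (rescale μ p ω (φ ω))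
        ≤ normSqH1 (rescale μ p ω (φ ω)) ^ p := by
    filter_upwards [hgs, hlow (1 / 2) (by norm_num) (by norm_num)] with ω ⟨_, _, hH, h0, _⟩ hl
    have hn : 0 < normSqH1 (rescale μ p ω (φ ω)) := add_pos_of_nonneg_of_pos (gradSq_nonneg _) h0
    -- The rescaled ground state competes in the limit problem; its nonlocal term is positive by the
    -- lower bound `hl` with `δ = 1 / 2`.
    have h := nonlocal_rpow_mul_le hp hψ (w := rescale μ p ω (φ ω)) ⟨hH, by simp⟩ h0
      (by rwa [hquad0]) (by linarith)
    rw [hquad0] at h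
    exact ⟨hn, h⟩
  have hup : ∀ a > nonlocal μ p ψ, ∀ᶠ ω in atTop, nonlocal μ p (rescale μ p ω (φ ω)) < a := by
    intro a ha
    have ha0 : 0 < a := hN0.trans ha
    have hF := tendsto_nonlocal_truncate (by linarith) hψH.1.1 hN0.ne'
    have hn := hψH.tendsto_normSqH1_truncate
    rw [hψN] at hn
    have hl : Tendsto (fun k => normSqL2 (truncate k ψ)) atTop (𝓝 (normSqL2 ψ)) :=
      tendsto_normSqL2 hψH.1.norm (fun k => aestronglyMeasurable_truncate k hψH.1.1)
        (fun k x => norm_truncate_le k ψ x) (tendsto_truncate ψ)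
    -- The inequality is strict, so it survives a sufficiently late truncation; `k` is fixed here,
    -- before `ω` tends to infinity.
    have hlt : nonlocal μ p ψ ^ p < a ^ (p - 1) * nonlocal μ p ψ := by
      calc nonlocal μ p ψ ^ p = nonlocal μ p ψ ^ (p - 1) * nonlocal μ p ψ := by
            rw [← Real.rpow_add_one hN0.ne', sub_add_cancel]
        _ < _ := by gcongr
    obtain ⟨k, hk1, hk2, hk3, hk4⟩ := (((hn.rpow_const (Or.inr (by linarith))).eventually_lt
      (hF.const_mul (a ^ (p - 1))) hlt).and ((hF.eventually (lt_mem_nhds hN0)).and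
      ((hn.eventually (lt_mem_nhds hN0)).and
        (hl.eventually (lt_mem_nhds (normSqL2_pos hψH.1 hψ.2.1)))))).exists
    have hkH := hψH.truncate k
    have hkc := hasCompactSupport_truncate k ψ
    have hQ : Tendsto (fun ω => normSqH1 (truncate k ψ) + scaledPotential ω V (truncate k ψ)) atTop
        (𝓝 (normSqH1 (truncate k ψ))) := by
      simpa using (hV.tendsto_scaledPotential hkH hkc).const_add (normSqH1 (truncate k ψ))
    filter_upwards [hgs, hQ.eventually (lt_mem_nhds hk3),
      (hQ.rpow_const (p := p) (Or.inr (by linarith))).eventually (gt_mem_nhds hk1)]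
      with ω ⟨hω0, hω, _⟩ h1 h2
    have h := (nonlocal_rescale_rpow_mul_le hp hω0 hV₁ hω hkH hkc hk4 h1 hk2).trans_lt h2
    rw [← Real.rpow_lt_rpow_iff (nonlocal_nonneg _ _ _) ha0.le hp0]
    exact lt_of_mul_lt_mul_right h hk2.le
  obtain ⟨hf, hn⟩ := tendsto_of_minimality hN0 hp hlow hmin hup
  refine ⟨hf, ?_, hψN ▸ hn⟩
  -- By the Nehari identity the rescaled potential energy is exactly the difference of the two
  -- quantities already shown to share a limit.
  have h := hf.sub hn
  rw [sub_self] at h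
  refine h.congr' ?_
  filter_upwards [hgs] with ω ⟨_, _, _, _, he⟩
  rw [← he]
  exact add_sub_cancel_left _ _
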